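/- Let $X$ be a complex Banach space. For $0<\theta<\pi$ let $S_\theta=\{z\in\mathbb C: z\neq 0,\ |\arg z|<\theta\}$. For a densely defined operator $A$ on $X$ and $\omega\in(0,\pi)$ write $A\in\operatorname{Sect}(\omega)$ if $\sigma(A)\cap(-\infty,0)=\emptyset$, $\sup_{s>0}\|(1+sA)^{-1}\|<\infty$, $\sigma(A)\subset\overline{S_\omega}$ and $\sup\{\|z(z-A)^{-1}\|: z\notin\overline{S_\omega}\}<\infty$. For $\phi\in(0,\pi)$ let $H_0^\infty(S_\phi)$ be the set of holomorphic functions $f$ on $S_\phi$ such that $|f(z)|\le C\min(|z|^s,|z|^{-s})$ on $S_\phi$ for some $C,s>0$, and let $\mathcal B(S_\phi)$ be the set of functions $f$ on $S_\phi$ such that $\tau^nf\in H_0^\infty(S_\phi)$ for some $n\in\mathbb N$, where $\tau(z)=z/(1+z)^2$. Let $A\in\operatorname{Sect}(\omega)$ be injective. For $\omega<\phi<\pi$ and $f\in H_0^\infty(S_\phi)$ let $$f(A)=\frac1{2\pi i}\int_\Gamma f(z)(z-A)^{-1}\,dz\in\mathcal L(X),$$ where $\Gamma$ is the downward oriented boundary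 of $S_{\omega_0}$ for any $\omega_0\in(\omega,\phi)$. For $f\in\mathcal B(S_\phi)$ let $f(A)$ be the closed operator $f(A)=e(A)^{-1}(ef)(A)$, where $e\in H_0^\infty(S_\phi)$ is any function such that $ef\in H_0^\infty(S_\phi)$ and $e(A)$ is injective (for instance $e=\tau^n$ with $n$ large); this does not depend on the choice of $e$ and $\omega_0$, nor on $\phi$ when functions are identified with their restrictions to smaller sectors. Let $H(A)$ be the set of all $f\in\bigcup_{\omega<\phi<\pi}\mathcal B(S_\phi)$ for which $f(A)\in\mathcal L(X)$. Products of operators have their natural domain $\operatorname{dom}(ST)=\{x\in\operatorname{dom}(T): Tx\in\operatorname{dom}(S)\}$. **Corollary.** Let $A\in\operatorname{Sect}(\omega)$ be injective, let $\phi\in(\omega,\pi)$ and $f,g\in\mathcal B(S_\phi)$. Assume that $f$ has no zeros in $S_\phi$, that $1/f\in\mathcal B(S_\phi)$, and that $$\frac{f(z)}{(1+z)^k}\in H(A),\qquad \frac{g(z)}{(1+z)^m}\in H(A),\qquad \frac{z^r}{f(z)(1+z)^r}\in H(A)$$ for some $k,m,r\in\mathbb N\cup\{0\}$. Then $(fg)(A)=f(A)g(A)$,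 including equality of domains. -/

import Mathlib

open MeasureTheory

noncomputable section

namespace HolCalc

variable {X : Type*} [NormedAddCommGroup X] [NormedSpace ℂ X]

/-! ### Unbounded operators -/

/-- The product (composition) `S T` of two operators, with its natural domain
`{x ∈ dom T | T x ∈ dom S}`. -/
def opMul (S T : X →ₗ.[ℂ] X) : X →ₗ.[ℂ] X :=
  S.comp (T.domRestrict ((S.domain.comap T.toFun).map T.domain.subtype)) (by
    rintro ⟨x, ⟨y, hy, hyx⟩, hx⟩
    have hxy : y = ⟨x, hx⟩ := Subtype.ext hyx
    subst hxy
    exact hy)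

theorem mem_opMul_domain {S T : X →ₗ.[ℂ] X} {x : X} :
    x ∈ (opMul S T).domain ↔ ∃ h : x ∈ T.domain, T ⟨x, h⟩ ∈ S.domain := by
  constructor
  · rintro ⟨⟨y, hy, hyx⟩, hx⟩
    have hxy : y = ⟨x, hx⟩ := Subtype.ext hyx
    subst hxy
    exact ⟨hx, hy⟩
  · rintro ⟨h, h'⟩
    exact ⟨⟨⟨x, h⟩, h', rfl⟩, h⟩

theorem opMul_apply {S T : X →ₗ.[ℂ] X} (x : X) (hx : x ∈ (opMul S T).domain)
    (h : x ∈ T.domain) (h' : T ⟨x, h⟩ ∈ S.domain) :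
    opMul S T ⟨x, hx⟩ = S ⟨T ⟨x, h⟩, h'⟩ := rfl

/-- A bounded operator, seen as an operator with domain `X`. -/
def ofBdd (B : X →L[ℂ] X) : X →ₗ.[ℂ] X := (B : X →ₗ[ℂ] X).toPMap ⊤

/-- `T` belongs to `L(X)`: it is everywhere defined and bounded. -/
def IsBddOp (T : X →ₗ.[ℂ] X) : Prop := ∃ B : X →L[ℂ] X, T = ofBdd B

/-- The operator `a + b A` with domain `dom A`. -/
def affineOp (A : X →ₗ.[ℂ] X) (a b : ℂ) : X →ₗ.[ℂ] X :=
  ⟨A.domain, a • A.domain.subtype + b • A.toFun⟩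

/-- `B` is the bounded, everywhere defined, two-sided inverse of `T : dom T → X`. -/
def IsBddInverse (T : X →ₗ.[ℂ] X) (B : X →L[ℂ] X) : Prop :=
  (∀ x : X, ∃ h : B x ∈ T.domain, T ⟨B x, h⟩ = x) ∧ ∀ y : T.domain, B (T y) = y

open Classical in
/-- The bounded inverse of `T` if there is one (it is then unique), and `0` otherwise. -/
def bddInverse (T : X →ₗ.[ℂ] X) : X →L[ℂ] X :=
  if h : ∃ B, IsBddInverse T B then h.choose else 0

/-- The spectrum of an operator: the `z` for which `z - A` has no bounded inverse. -/
def opSpectrum (A : X →ₗ.[ℂ] X) : Set ℂ :=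
  {z | ¬ ∃ B, IsBddInverse (affineOp A z (-1)) B}

/-- The resolvent `(z - A)⁻¹`. -/
def opResolvent (A : X →ₗ.[ℂ] X) (z : ℂ) : X →L[ℂ] X :=
  bddInverse (affineOp A z (-1))

/-! ### Sectorial operators -/

/-- The open sector `S_ω`, symmetric about the positive real axis, with half-angle `ω`. -/
def sector (ω : ℝ) : Set ℂ := {z | z ≠ 0 ∧ |z.arg| < ω}

/-- Sectorial (non-negative) operators: densely defined, `σ(A)` does not meet `(-∞, 0)`, and
`sup_{s > 0} ‖(1 + s A)⁻¹‖ < ∞`. -/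
def IsSectorial (A : X →ₗ.[ℂ] X) : Prop :=
  Dense (A.domain : Set X) ∧
  (∀ t : ℝ, t < 0 → (t : ℂ) ∉ opSpectrum A) ∧
  ∃ M : ℝ, ∀ s : ℝ, 0 < s → ‖bddInverse (affineOp A 1 (s : ℂ))‖ ≤ M

/-- `A ∈ Sect(ω)`, for an angle `ω ∈ (0, π)`: `A` is sectorial, `σ(A)` is contained in the closure
of `S_ω`, and `sup {‖z (z - A)⁻¹‖ : z ∉ closure S_ω} < ∞`. -/
def IsSect (A : X →ₗ.[ℂ] X) (ω : ℝ) : Prop :=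
  0 < ω ∧ ω < Real.pi ∧ IsSectorial A ∧
  opSpectrum A ⊆ closure (sector ω) ∧
  ∃ M : ℝ, ∀ z : ℂ, z ∉ closure (sector ω) → ‖z • opResolvent A z‖ ≤ M

/-! ### Function classes

Functions on `S_φ` are represented by functions `ℂ → ℂ`; every notion below depends only on
their restriction to `S_φ`. -/

/-- `H₀^∞(S_φ)`: the holomorphic functions on `S_φ` with `|f(z)| ≤ C min(|z|^s, |z|^(-s))`
for some `C, s > 0`. -/
def H0 (φ : ℝ) : Set (ℂ → ℂ) :=
  {f | DifferentiableOn ℂ f (sector φ) ∧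
    ∃ C s : ℝ, 0 < C ∧ 0 < s ∧ ∀ z ∈ sector φ, ‖f z‖ ≤ C * min (‖z‖ ^ s) (‖z‖ ^ (-s))}

/-- `τ(z) = z / (1 + z)²`. -/
def tau (z : ℂ) : ℂ := z / (1 + z) ^ 2

/-- `B(S_φ)`: the functions `f` with `τ^n f ∈ H₀^∞(S_φ)` for some `n`. -/
def BSect (φ : ℝ) : Set (ℂ → ℂ) :=
  {f | ∃ n : ℕ, (fun z => tau z ^ n * f z) ∈ H0 φ}

/-! ### The holomorphic functional calculus -/

/-- The elementary calculus on `H₀^∞(S_φ)`, for `A ∈ Sect(ω)` and `ω < φ < π`: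
`(2πi)⁻¹ ∫_Γ f(z) (z - A)⁻¹ dz`, where `Γ` is the boundary of `S_θ`, oriented downwards: it comes
in from infinity along the ray `arg z = θ` and goes out along the ray `arg z = -θ`. Here `θ` may
be any angle between `ω` and `φ` (the value does not depend on it); we take the midpoint. -/
def elemCalc (A : X →ₗ.[ℂ] X) (ω φ : ℝ) (f : ℂ → ℂ) : X →L[ℂ] X :=
  let u : ℂ := Complex.exp (((ω + φ) / 2 : ℝ) * Complex.I)
  let v : ℂ := Complex.exp (-((ω + φ) / 2 : ℝ) * Complex.I)
  (2 * Real.pi * Complex.I)⁻¹ •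
    ((∫ t in Set.Ioi (0 : ℝ), (f (t * v) * v) • opResolvent A (t * v)) -
      ∫ t in Set.Ioi (0 : ℝ), (f (t * u) * u) • opResolvent A (t * u))

/-- The regularisers of `f`: the `e ∈ H₀^∞(S_φ)` with `e f ∈ H₀^∞(S_φ)` and `e(A)` injective. -/
def Reg (A : X →ₗ.[ℂ] X) (ω φ : ℝ) (f : ℂ → ℂ) : Set (ℂ → ℂ) :=
  {e | e ∈ H0 φ ∧ (fun z => e z * f z) ∈ H0 φ ∧ Function.Injective (elemCalc A ω φ e)}

open Classical in
/-- The extended holomorphic calculus `f(A) = e(A)⁻¹ (e f)(A)`, where `e` is an arbitrary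
regulariser of `f` (the operator does not depend on it). If `A` is injective, then each
`f ∈ B(S_φ)` has a regulariser of the form `τ^n`. The value is a placeholder (the operator with
domain `{0}`) if `f` has no regulariser. -/
def holCalc (A : X →ₗ.[ℂ] X) (ω φ : ℝ) (f : ℂ → ℂ) : X →ₗ.[ℂ] X :=
  if h : (Reg A ω φ f).Nonempty then
    opMul (ofBdd (elemCalc A ω φ h.some)).inverse
      (ofBdd (elemCalc A ω φ (fun z => h.some z * f z)))
  else ⊥

/-- `H(A)`: the `f` in `B[S_ω] = ⋃_{ω < φ < π} B(S_φ)` for which `f(A)` is a bounded operator. -/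
def HBdd (A : X →ₗ.[ℂ] X) (ω : ℝ) : Set (ℂ → ℂ) :=
  {f | ∃ φ : ℝ, ω < φ ∧ φ < Real.pi ∧ f ∈ BSect φ ∧ IsBddOp (holCalc A ω φ f)}

end HolCalc

end

noncomputable section

namespace HolCalc

open Set Filter Topology Complex

/-! ### Cauchy's theorem and integral formula on horizontal strips -/

section Strip

variable {E : Type*} [NormedAddCommGroup E]

/-! For any regulariser `e`, the graph of `f(A)` is `{(x, y) | e(A) y = (e f)(A) x}`. Elementary
operators multiply and commute, and `e(A)` is injective, so for `x ∈ dom g(A)` the statements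
`(fg)(A) x = z` and `f(A) g(A) x = z` are equivalent (`mem_graph_holCalc_mul_iff`). What remains is
the inclusion `dom (fg)(A) ⊆ dom g(A)` (`exists_mem_graph_holCalc_right`).

Put `t = 1/(1+z)` and `T = (1+A)⁻¹`. The polynomials `(1-t)^r` and `t^m` are coprime, so
`p(t)(1-t)^r + q(t) t^m = 1` for some `p, q`. Since `1 - t = z/(1+z)`, multiplication by `g` gives
`g = p(t) · [z^r / (f (1+z)^r)] · (f g) + q(t) · [g / (1+z)^m]`. The brackets have bounded operators
`B₃` and `B₂`, which suggests `g(A) x = p(T) B₃ (fg)(A) x + q(T) B₂ x`; the right side makes sense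
on all of `dom (fg)(A)`, and regularisation confirms the equality there.

Most of the work is the elementary calculus itself. The substitution `z = exp w` turns the rays of
the contour into horizontal lines and power decay into exponential decay. Three facts are extracted
for an abstract resolvent family: multiplicativity (`IsSectResolvent.contourCalc_mul`),
compatibility with `T` (`IsSectResolvent.contourCalc_mul_resolvent`), and `τ(A) = T - T²`
(`IsSectResolvent.contourCalc_tau`). The last makes `τ(A)` injective, so that large powers of `τ`
are regularisers. -/

theorem integrable_exp_neg_mul_abs {s : ℝ} (hs : 0 < s) :
    Integrable fun x : ℝ => Real.exp (-(s * |x|)) := by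
  rw [← integrableOn_univ, ← Iic_union_Ioi (a := (0 : ℝ))]
  refine IntegrableOn.union ?_ ?_
  · refine (integrableOn_exp_mul_Iic hs 0).congr_fun (fun x hx => ?_) measurableSet_Iic
    simp [abs_of_nonpos (mem_Iic.1 hx)]
  · refine (integrableOn_exp_mul_Ioi (neg_lt_zero.2 hs) 0).congr_fun (fun x hx => ?_)
      measurableSet_Ioi
    simp [abs_of_pos (mem_Ioi.1 hx)]

theorem integrable_of_exp_decay {F : ℝ → E} (hF : Continuous F) {C s N : ℝ} (hs : 0 < s)
    (hb : ∀ x, N ≤ |x| → ‖F x‖ ≤ C * Real.exp (-(s * |x|))) : Integrable F := by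
  obtain ⟨K, hK⟩ := (isCompact_Icc (a := -N) (b := N)).exists_bound_of_continuousOn hF.continuousOn
  refine ((integrable_exp_neg_mul_abs hs).const_mul (max C (K * Real.exp (s * N)))).mono'
    hF.aestronglyMeasurable (.of_forall fun x => ?_)
  rcases le_total N |x| with h | h
  · exact (hb x h).trans (by gcongr; exact le_max_left _ _)
  · have hx := hK x (abs_le.1 h)
    have h0 : 0 ≤ K := (norm_nonneg _).trans hx
    calc ‖F x‖ ≤ K * (Real.exp (s * N) * Real.exp (-(s * |x|))) := by
          rw [← Real.exp_add]
          refine hx.trans (le_mul_of_one_le_right h0 (Real.one_le_exp ?_))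
          nlinarith
      _ ≤ _ := by rw [← mul_assoc]; gcongr; exact le_max_right _ _

theorem continuous_line {G : ℂ → E} {S : Set ℂ} {y : ℝ} (hG : ContinuousOn G S)
    (h : ∀ w : ℂ, w.im = y → w ∈ S) : Continuous fun x : ℝ => G (x + y * I) :=
  hG.comp_continuous (by fun_prop) fun x => h _ (by simp)

theorem integrable_line {G : ℂ → E} {a b y C s N : ℝ} (hs : 0 < s) (hay : a ≤ y) (hyb : y ≤ b)
    (hG : ContinuousOn G {w | a ≤ w.im ∧ w.im ≤ b})
    (hb : ∀ w : ℂ, a ≤ w.im → w.im ≤ b → N ≤ |w.re| → ‖G w‖ ≤ C * Real.exp (-(s * |w.re|))) :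
    Integrable fun x : ℝ => G (x + y * I) :=
  integrable_of_exp_decay (N := N) (C := C) (continuous_line hG fun w hw => by simp [hw, hay, hyb])
    hs fun x hx => by simpa using hb (x + y * I) (by simpa) (by simpa) (by simpa)

variable [NormedSpace ℂ E]

/-- The integral of `G` along the horizontal line of height `y`. -/
def lineInt (G : ℂ → E) (y : ℝ) : E := ∫ x : ℝ, G (x + y * I)

theorem lineInt_congr {G H : ℂ → E} {y : ℝ} (h : ∀ w : ℂ, w.im = y → G w = H w) :
    lineInt G y = lineInt H y :=
  integral_congr_ae (.of_forall fun x => h _ (by simp))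

/-- Cauchy's theorem on the rectangles with real part in `[-n, n]`: the vertical sides contribute
`O(exp (-s n))` and vanish as `n → ∞`. -/
theorem lineInt_shift {G : ℂ → E} {a b C s N : ℝ} (hab : a ≤ b) (hs : 0 < s)
    (hd : DifferentiableOn ℂ G {w | a ≤ w.im ∧ w.im ≤ b})
    (hb : ∀ w : ℂ, a ≤ w.im → w.im ≤ b → N ≤ |w.re| → ‖G w‖ ≤ C * Real.exp (-(s * |w.re|))) :
    lineInt G a = lineInt G b := by
  have hia := integrable_line hs le_rfl hab hd.continuousOn hb
  have hib := integrable_line hs hab le_rfl hd.continuousOn hb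
  have hA := intervalIntegral_tendsto_integral hia tendsto_neg_atTop_atBot tendsto_id
  have hB := intervalIntegral_tendsto_integral hib tendsto_neg_atTop_atBot tendsto_id
  have hexp : Tendsto (fun n : ℝ => C * Real.exp (-(s * n)) * |b - a|) atTop (𝓝 0) := by
    have : Tendsto (fun n : ℝ => Real.exp (-(s * n))) atTop (𝓝 0) :=
      Real.tendsto_exp_neg_atTop_nhds_zero.comp (tendsto_id.const_mul_atTop hs)
    simpa using (this.const_mul C).mul_const |b - a|
  have side : ∀ σ : ℝ, |σ| = 1 →
      Tendsto (fun n : ℝ => ∫ y in a..b, G ((σ * n : ℝ) + y * I)) atTop (𝓝 0) := by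
    intro σ hσ
    refine squeeze_zero_norm' ?_ hexp
    filter_upwards [eventually_ge_atTop N, eventually_ge_atTop 0] with n hn hn0
    refine intervalIntegral.norm_integral_le_of_norm_le_const fun y hy => ?_
    rw [uIoc_of_le hab] at hy
    have hre : |((σ * n : ℝ) + y * I : ℂ).re| = n := by
      simp [abs_mul, hσ, abs_of_nonneg hn0]
    have := hb ((σ * n : ℝ) + y * I) (by simpa using hy.1.le) (by simpa using hy.2) (by rw [hre]; exact hn)
    rwa [hre] at this
  have hR := side 1 (by simp)
  have hL := side (-1) (by simp)
  have key : ∀ n : ℝ, (∫ x in (-n)..n, G (x + a * I)) - (∫ x in (-n)..n, G (x + b * I)) +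
      I • (∫ y in a..b, G ((1 * n : ℝ) + y * I)) - I • (∫ y in a..b, G ((-1 * n : ℝ) + y * I)) = 0 := by
    intro n
    have := integral_boundary_rect_eq_zero_of_differentiableOn G ((-n : ℝ) + a * I) (n + b * I)
      (hd.mono fun w hw => by
        have h2 := hw.2
        simp only [add_im, ofReal_im, mul_im, ofReal_re, I_im, I_re, mul_one, mul_zero, zero_add,
          add_zero, uIcc_of_le hab, mem_preimage] at h2
        exact h2)
    simpa using this
  have hlim := (((hA.sub hB).add (hR.const_smul I)).sub (hL.const_smul I)).congr key
  have h0 := tendsto_nhds_unique hlim tendsto_const_nhds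
  simpa [sub_eq_zero, lineInt] using h0

theorem exp_div_four_le_norm_sinh {w : ℂ} (hw : 1 ≤ |w.re|) :
    Real.exp |w.re| / 4 ≤ ‖sinh w‖ := by
  have h2 : Real.exp (-|w.re|) ≤ Real.exp |w.re| / 2 := by
    have h1 : Real.exp (-|w.re|) ≤ 1 / 2 := by
      calc Real.exp (-|w.re|) ≤ Real.exp (-1) := by gcongr
        _ ≤ 1 / 2 := by
          rw [Real.exp_neg, inv_eq_one_div]
          gcongr
          linarith [Real.add_one_le_exp 1]
    have h3 : 1 ≤ Real.exp |w.re| := Real.one_le_exp (abs_nonneg _)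
    linarith
  have h : Real.exp |w.re| - Real.exp (-|w.re|) ≤ ‖exp w - exp (-w)‖ := by
    rcases abs_cases w.re with ⟨h, -⟩ | ⟨h, -⟩
    · rw [h]
      simpa [norm_exp] using norm_sub_norm_le (exp w) (exp (-w))
    · rw [h, norm_sub_rev]
      simpa [norm_exp] using norm_sub_norm_le (exp (-w)) (exp w)
  rw [sinh, norm_div]
  simp only [RCLike.norm_ofNat]
  linarith

theorem norm_inv_sinh_le {w : ℂ} (hw : 1 ≤ |w.re|) :
    ‖(sinh w)⁻¹‖ ≤ 4 * Real.exp (-(1 * |w.re|)) := by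
  have h := exp_div_four_le_norm_sinh hw
  rw [norm_inv, one_mul, Real.exp_neg]
  calc ‖sinh w‖⁻¹ ≤ (Real.exp |w.re| / 4)⁻¹ := by gcongr
    _ = _ := by field_simp

theorem exp_ne_one_of_im {w : ℂ} (h0 : 0 < w.im) (h1 : w.im < 2 * Real.pi) : exp w ≠ 1 := by
  intro h
  obtain ⟨n, hn⟩ := exp_eq_one_iff.1 h
  have him : w.im = n * (2 * Real.pi) := by rw [hn]; simp
  have hn0 : 0 < n := by
    by_contra hc
    have : (n : ℝ) ≤ 0 := by exact_mod_cast not_lt.1 hc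
    nlinarith [Real.pi_pos]
  have : (1 : ℝ) ≤ n := by exact_mod_cast hn0
  nlinarith [Real.pi_pos]

theorem exp_ne_exp_of_im {w z : ℂ} (h0 : z.im < w.im) (h1 : w.im < z.im + 2 * Real.pi) :
    exp w ≠ exp z := by
  intro h
  refine exp_ne_one_of_im (w := w - z) (by simpa) (by simp; linarith) ?_
  rw [exp_sub, h, div_self (exp_ne_zero z)]

theorem sinh_ne_zero_of_im {w : ℂ} (h0 : w ≠ 0) (h1 : |w.im| < Real.pi) : sinh w ≠ 0 := by
  intro h
  have h2 : exp (2 * w) = 1 := by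
    have : exp w = exp (-w) := by
      rw [sinh, div_eq_zero_iff] at h
      exact sub_eq_zero.1 (h.resolve_right two_ne_zero)
    rw [two_mul, exp_add]
    nth_rw 2 [this]
    rw [← exp_add]; simp
  obtain ⟨n, hn⟩ := exp_eq_one_iff.1 h2
  have hw : w = n * (Real.pi * I) := by linear_combination hn / 2
  have him : w.im = n * Real.pi := by rw [hw]; simp
  have hn0 : n ≠ 0 := by rintro rfl; exact h0 (by simpa using hw)
  have : (1 : ℝ) ≤ |(n : ℝ)| := by exact_mod_cast Int.one_le_abs hn0
  rw [him, abs_mul, abs_of_pos Real.pi_pos] at h1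
  nlinarith [Real.pi_pos]

theorem integral_inv_cosh : ∫ x : ℝ, (Real.cosh x)⁻¹ = Real.pi := by
  have hd : ∀ x : ℝ, HasDerivAt (fun x => 2 * Real.arctan (Real.exp x)) ((Real.cosh x)⁻¹) x := by
    intro x
    refine ((Real.hasDerivAt_exp x).arctan.const_mul 2).congr_deriv ?_
    rw [Real.cosh_eq, Real.exp_neg]
    have := Real.exp_pos x
    field_simp
    ring
  have hi : Integrable fun x : ℝ => (Real.cosh x)⁻¹ := by
    refine integrable_of_exp_decay (C := 2) (s := 1) (N := 0)
      (Real.continuous_cosh.inv₀ fun x => (Real.cosh_pos x).ne') one_pos fun x _ => ?_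
    have h : Real.exp |x| / 2 ≤ Real.cosh x := by
      rw [← Real.cosh_abs, Real.cosh_eq]
      linarith [Real.exp_pos (-|x|)]
    rw [norm_inv, Real.norm_of_nonneg (Real.cosh_pos x).le, one_mul, Real.exp_neg]
    calc (Real.cosh x)⁻¹ ≤ (Real.exp |x| / 2)⁻¹ := by gcongr
      _ = _ := by field_simp
  have hbot : Tendsto (fun x => 2 * Real.arctan (Real.exp x)) atBot (𝓝 0) := by
    have := ((Real.continuous_arctan.tendsto 0).comp Real.tendsto_exp_atBot).const_mul 2
    simpa using this
  have htop : Tendsto (fun x => 2 * Real.arctan (Real.exp x)) atTop (𝓝 Real.pi) := by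
    have := ((Real.tendsto_arctan_atTop.mono_right nhdsWithin_le_nhds).comp
      Real.tendsto_exp_atTop).const_mul 2
    simpa [mul_div_cancel₀] using this
  rw [integral_of_hasDerivAt_of_tendsto hd hi hbot htop, sub_zero]

theorem lineInt_inv_sinh_half_pi :
    lineInt (fun w => (sinh w)⁻¹) (Real.pi / 2) = -(Real.pi * I) := by
  have h : ∀ x : ℝ, (sinh (x + (Real.pi / 2 : ℝ) * I))⁻¹ = (-I) * (((Real.cosh x)⁻¹ : ℝ) : ℂ) := by
    intro x
    rw [sinh_add, sinh_mul_I, cosh_mul_I, ← ofReal_cos, ← ofReal_sin]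
    simp [mul_comm]
  simp only [lineInt, h]
  rw [integral_const_mul, integral_complex_ofReal, integral_inv_cosh]
  ring

/-- `sinh` has no zero with `0 < Im w < π`, so the integral does not depend on the height; at height
`π/2` the integrand is `-i / cosh x`. -/
theorem lineInt_inv_sinh {δ : ℝ} (h0 : 0 < δ) (h1 : δ < Real.pi) :
    lineInt (fun w => (sinh w)⁻¹) δ = -(Real.pi * I) := by
  rw [← lineInt_inv_sinh_half_pi]
  have hpi := Real.pi_pos
  have main : ∀ a b : ℝ, 0 < a → a ≤ b → b < Real.pi →
      lineInt (fun w => (sinh w)⁻¹) a = lineInt (fun w => (sinh w)⁻¹) b := by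
    intro a b ha hab hb
    refine lineInt_shift (C := 4) (N := 1) (s := 1) hab one_pos ?_ fun w _ _ h => norm_inv_sinh_le h
    refine DifferentiableOn.inv (by fun_prop) fun w hw => ?_
    refine sinh_ne_zero_of_im (fun h => ?_) ?_
    · rw [h] at hw; exact absurd hw.1 (by simpa)
    · rw [abs_of_pos (by linarith [hw.1])]; linarith [hw.2]
  rcases le_total δ (Real.pi / 2) with h | h
  · exact main _ _ h0 h (by linarith)
  · exact (main _ _ (by linarith) h h1).symm

theorem lineInt_inv_sinh_neg {δ : ℝ} (h0 : 0 < δ) (h1 : δ < Real.pi) :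
    lineInt (fun w => (sinh w)⁻¹) (-δ) = Real.pi * I := by
  have : lineInt (fun w => (sinh w)⁻¹) (-δ) = -lineInt (fun w => (sinh w)⁻¹) δ := by
    rw [lineInt, lineInt, ← integral_neg, ← integral_neg_eq_self]
    congr 1; ext x
    rw [← inv_neg, ← sinh_neg]
    congr 2; push_cast; ring
  rw [this, lineInt_inv_sinh h0 h1, neg_neg]

theorem lineInt_comp_sub (G : ℂ → E) (ζ : ℂ) (y : ℝ) :
    lineInt (fun w => G (w - ζ)) y = lineInt G (y - ζ.im) := by
  rw [lineInt, lineInt, ← integral_sub_right_eq_self (fun x : ℝ => G (x + (y - ζ.im : ℝ) * I)) ζ.re]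
  congr 1; ext x; congr 1
  apply Complex.ext <;> simp

theorem lineInt_add {G H : ℂ → E} {y : ℝ} (hG : Integrable fun x : ℝ => G (x + y * I))
    (hH : Integrable fun x : ℝ => H (x + y * I)) :
    lineInt (fun w => G w + H w) y = lineInt G y + lineInt H y := integral_add hG hH

theorem lineInt_sub {G H : ℂ → E} {y : ℝ} (hG : Integrable fun x : ℝ => G (x + y * I))
    (hH : Integrable fun x : ℝ => H (x + y * I)) :
    lineInt (fun w => G w - H w) y = lineInt G y - lineInt H y := integral_sub hG hH

theorem lineInt_smul (c : ℂ) (G : ℂ → E) (y : ℝ) :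
    lineInt (fun w => c • G w) y = c • lineInt G y := integral_smul _ _

theorem lineInt_smul_const [CompleteSpace E] (G : ℂ → ℂ) (c : E) (y : ℝ) :
    lineInt (fun w => G w • c) y = lineInt G y • c := integral_smul_const _ _

theorem norm_inv_sinh_sub_le {w ζ : ℂ} (hw : |ζ.re| + 1 ≤ |w.re|) :
    ‖(sinh (w - ζ))⁻¹‖ ≤ 4 * Real.exp |ζ.re| * Real.exp (-(1 * |w.re|)) := by
  have h1 : |w.re| - |ζ.re| ≤ |(w - ζ).re| := by simpa using abs_sub_abs_le_abs_sub w.re ζ.re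
  refine (norm_inv_sinh_le (by linarith)).trans ?_
  rw [mul_assoc, ← Real.exp_add]
  gcongr
  linarith

/-- Cauchy's integral formula on a strip, with the kernel `1 / sinh`. -/
theorem lineInt_sub_lineInt_inv_sinh [CompleteSpace E] {H : ℂ → E} {a b α β C s N : ℝ} {ζ : ℂ}
    (hs : 0 < s) (hd : DifferentiableOn ℂ H {w | a < w.im ∧ w.im < b})
    (ha : a < α) (hα : α < ζ.im) (hβ : ζ.im < β) (hb : β < b)
    (hα' : ζ.im - α < Real.pi) (hβ' : β - ζ.im < Real.pi)
    (hbd : ∀ w : ℂ, α ≤ w.im → w.im ≤ β → N ≤ |w.re| →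
      ‖(sinh (w - ζ))⁻¹ • H w‖ ≤ C * Real.exp (-(s * |w.re|))) :
    lineInt (fun w => (sinh (w - ζ))⁻¹ • H w) α - lineInt (fun w => (sinh (w - ζ))⁻¹ • H w) β =
      (2 * Real.pi * I) • H ζ := by
  set U : Set ℂ := {w | a < w.im ∧ w.im < b} with hU
  have hUo : IsOpen U := (isOpen_lt continuous_const continuous_im).inter
    (isOpen_lt continuous_im continuous_const)
  have hζU : ζ ∈ U := ⟨by linarith, by linarith⟩
  -- `D` is `(H w - H ζ) / sinh (w - ζ)` with its removable singularity at `ζ` filled in, so its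
  -- line integrals agree on both sides of `ζ`.
  set D : ℂ → E := fun w => (dslope sinh 0 (w - ζ))⁻¹ • dslope H ζ w with hD
  have hDeq : ∀ w, w ≠ ζ → D w = (sinh (w - ζ))⁻¹ • H w - (sinh (w - ζ))⁻¹ • H ζ := by
    intro w hw
    have h1 : w - ζ ≠ 0 := sub_ne_zero.2 hw
    simp only [hD]
    rw [dslope_of_ne _ hw, dslope_of_ne _ h1, slope_def_module, slope_def_module, ← smul_sub,
      smul_smul]
    congr 1
    simp only [sinh_zero, sub_zero, smul_eq_mul, mul_inv, inv_inv]
    field_simp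
  have hDd : DifferentiableOn ℂ D {w | α ≤ w.im ∧ w.im ≤ β} := by
    have hsub : {w : ℂ | α ≤ w.im ∧ w.im ≤ β} ⊆ U := fun w hw => ⟨by linarith [hw.1], by linarith [hw.2]⟩
    have h1 : DifferentiableOn ℂ (dslope H ζ) U :=
      (Complex.differentiableOn_dslope (hUo.mem_nhds hζU)).2 hd
    have h2 : Differentiable ℂ (dslope sinh 0) := by
      rw [← differentiableOn_univ, Complex.differentiableOn_dslope univ_mem]
      exact differentiable_sinh.differentiableOn
    refine DifferentiableOn.smul (DifferentiableOn.inv ?_ fun w hw => ?_) (h1.mono hsub)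
    · exact (h2.comp (by fun_prop : Differentiable ℂ fun w => w - ζ)).differentiableOn
    · rcases eq_or_ne w ζ with rfl | hne
      · rw [sub_self, dslope_same, Complex.deriv_sinh]; simp
      · have h3 : w - ζ ≠ 0 := sub_ne_zero.2 hne
        rw [dslope_of_ne _ h3, slope_def_module]
        simp only [sinh_zero, sub_zero, smul_eq_mul]
        refine mul_ne_zero (inv_ne_zero h3) (sinh_ne_zero_of_im h3 ?_)
        rw [sub_im, abs_lt]
        exact ⟨by linarith [hw.1], by linarith [hw.2]⟩
  set N' := max N (|ζ.re| + 1)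
  -- A decay rate valid for both terms of `D`: the first decays at rate `s`, the kernel `1 / sinh`
  -- at rate `1`.
  set s' := min s 1
  have hs' : 0 < s' := lt_min hs one_pos
  have hexp : ∀ t : ℝ, s' ≤ t → ∀ x : ℝ, Real.exp (-(t * |x|)) ≤ Real.exp (-(s' * |x|)) := by
    intro t ht x
    have := mul_le_mul_of_nonneg_right ht (abs_nonneg x)
    gcongr
  have hb1 : ∀ w : ℂ, N' ≤ |w.re| → ‖(sinh (w - ζ))⁻¹ • H ζ‖ ≤
      4 * Real.exp |ζ.re| * ‖H ζ‖ * Real.exp (-(s' * |w.re|)) := by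
    intro w hw
    rw [norm_smul]
    calc _ ≤ (4 * Real.exp |ζ.re| * Real.exp (-(1 * |w.re|))) * ‖H ζ‖ := by
          gcongr; exact norm_inv_sinh_sub_le ((le_max_right _ _).trans hw)
      _ ≤ (4 * Real.exp |ζ.re| * Real.exp (-(s' * |w.re|))) * ‖H ζ‖ := by
          gcongr ?_ * ?_ * _; exact hexp 1 (min_le_right _ _) _
      _ = _ := by ring
  have hb2 : ∀ w : ℂ, α ≤ w.im → w.im ≤ β → N' ≤ |w.re| →
      ‖(sinh (w - ζ))⁻¹ • H w‖ ≤ |C| * Real.exp (-(s' * |w.re|)) := by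
    intro w h1 h2 h3
    refine (hbd w h1 h2 ((le_max_left _ _).trans h3)).trans ?_
    exact mul_le_mul (le_abs_self C) (hexp s (min_le_left _ _) _) (Real.exp_pos _).le (abs_nonneg _)
  have hshift : lineInt D α = lineInt D β := by
    refine lineInt_shift (C := |C| + 4 * Real.exp |ζ.re| * ‖H ζ‖) (N := N') (by linarith) hs' hDd ?_
    intro w h1 h2 h3
    have hne : w ≠ ζ := by
      rintro rfl
      have := (le_max_right N (|w.re| + 1)).trans h3
      linarith
    rw [hDeq w hne, add_mul]
    exact (norm_sub_le _ _).trans (add_le_add (hb2 w h1 h2 h3) (hb1 w h3))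
  have hline : ∀ y, α ≤ y → y ≤ β → y ≠ ζ.im → |y - ζ.im| < Real.pi → lineInt D y =
      lineInt (fun w => (sinh (w - ζ))⁻¹ • H w) y -
        lineInt (fun w => (sinh w)⁻¹) (y - ζ.im) • H ζ := by
    intro y h1 h2 h3 h4
    have hne : ∀ w : ℂ, w.im = y → w - ζ ≠ 0 := by
      intro w hw h; rw [sub_eq_zero] at h; exact h3 (by rw [← hw, h])
    have hsn : ∀ w : ℂ, w.im = y → sinh (w - ζ) ≠ 0 := fun w hw =>
      sinh_ne_zero_of_im (hne w hw) (by rw [sub_im, hw]; exact h4)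
    have hc1 : Continuous fun x : ℝ => (sinh ((x + y * I : ℂ) - ζ))⁻¹ := by
      refine Continuous.inv₀ (by fun_prop) fun x => hsn _ (by simp)
    have hc2 : Continuous fun x : ℝ => H (x + y * I) :=
      continuous_line hd.continuousOn fun w hw => ⟨by rw [hw]; linarith, by rw [hw]; linarith⟩
    rw [← lineInt_comp_sub, ← lineInt_smul_const, ← lineInt_sub]
    · exact lineInt_congr fun w hw => hDeq w (sub_ne_zero.1 (hne w hw))
    · exact integrable_of_exp_decay (hc1.smul hc2) hs' fun x hx => by
        simpa using hb2 (x + y * I) (by simpa) (by simpa) (by simpa using hx)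
    · exact integrable_of_exp_decay (hc1.smul continuous_const) hs' fun x hx => by
        simpa using hb1 (x + y * I) (by simpa using hx)
  rw [hline α le_rfl (by linarith) hα.ne (by rw [abs_lt]; constructor <;> linarith),
    hline β (by linarith) le_rfl hβ.ne' (by rw [abs_lt]; constructor <;> linarith),
    lineInt_inv_sinh (by linarith) hβ', ← neg_sub ζ.im α,
    lineInt_inv_sinh_neg (by linarith) hα'] at hshift
  have h5 := sub_eq_iff_eq_add.1 hshift
  rw [h5]
  module

/-- Cauchy's integral formula on a strip of height less than `2π`, for the pullback of the
kernel `dz / (z - a)` under the exponential. -/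
theorem lineInt_sub_lineInt_cauchy [CompleteSpace E] {h : ℂ → E} {a b α β C s N : ℝ} {ζ : ℂ}
    (hs : 0 < s) (hd : DifferentiableOn ℂ h {w | a < w.im ∧ w.im < b})
    (ha : a < α) (hα : α < ζ.im) (hβ : ζ.im < β) (hb : β < b)
    (hα' : ζ.im - α < 2 * Real.pi) (hβ' : β - ζ.im < 2 * Real.pi)
    (hbd : ∀ w : ℂ, α ≤ w.im → w.im ≤ β → N ≤ |w.re| →
      ‖(exp w / (exp w - exp ζ)) • h w‖ ≤ C * Real.exp (-(s * |w.re|))) :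
    lineInt (fun w => (exp w / (exp w - exp ζ)) • h w) α -
      lineInt (fun w => (exp w / (exp w - exp ζ)) • h w) β = (2 * Real.pi * I) • h ζ := by
  have hpi := Real.pi_pos
  set K : ℂ → E := fun w => (exp w / (exp w - exp ζ)) • h w with hK
  -- The `sinh` kernel has further poles at `ζ ± πi`, which the exponential kernel lacks. The lines
  -- are therefore first moved to within `π/2` of `ζ`.
  set α' := max α (ζ.im - Real.pi / 2)
  set β' := min β (ζ.im + Real.pi / 2)
  have e1 : α ≤ α' := le_max_left _ _
  have e2 : α' < ζ.im := max_lt hα (by linarith)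
  have e3 : ζ.im < β' := lt_min hβ (by linarith)
  have e4 : β' ≤ β := min_le_left _ _
  have e5 : ζ.im - Real.pi / 2 ≤ α' := le_max_right _ _
  have e6 : β' ≤ ζ.im + Real.pi / 2 := min_le_right _ _
  have hKd : ∀ c d : ℝ, α ≤ c → d ≤ β → (∀ w : ℂ, c ≤ w.im → w.im ≤ d → exp w ≠ exp ζ) →
      DifferentiableOn ℂ K {w | c ≤ w.im ∧ w.im ≤ d} := by
    intro c d hc hd' hne
    refine DifferentiableOn.smul (DifferentiableOn.div (by fun_prop) (by fun_prop) fun w hw =>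
      sub_ne_zero.2 (hne w hw.1 hw.2)) (hd.mono fun w hw => ⟨?_, ?_⟩)
    · linarith [hw.1]
    · linarith [hw.2]
  have s1 : lineInt K α = lineInt K α' :=
    lineInt_shift e1 hs (hKd _ _ le_rfl (by linarith) fun w h1 h2 =>
      (exp_ne_exp_of_im (by linarith) (by linarith)).symm)
      fun w h1 h2 h3 => hbd w h1 (by linarith) h3
  have s2 : lineInt K β' = lineInt K β :=
    lineInt_shift e4 hs (hKd _ _ (by linarith) le_rfl fun w h1 h2 =>
      exp_ne_exp_of_im (by linarith) (by linarith)) fun w h1 h2 h3 => hbd w (by linarith) h2 h3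
  rw [s1, ← s2]
  -- With `u = w - ζ`, `exp u / (exp u - 1) = ((exp u + 1) / 2) / sinh u`; the extra factor equals
  -- `1` at `u = 0`.
  set H : ℂ → E := fun w => ((exp (w - ζ) + 1) / 2) • h w with hH
  have hKH : ∀ w : ℂ, w ≠ ζ → |(w - ζ).im| < Real.pi → K w = (sinh (w - ζ))⁻¹ • H w := by
    intro w hw him
    have h1 := sinh_ne_zero_of_im (sub_ne_zero.2 hw) him
    have h2 : exp w - exp ζ ≠ 0 := by
      intro h3
      refine h1 ?_
      have h4 : exp (w - ζ) = 1 := by rw [exp_sub, sub_eq_zero.1 h3, div_self (exp_ne_zero _)]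
      rw [sinh, exp_neg, h4]; simp
    simp only [hK, hH]
    rw [smul_smul]
    congr 1
    rw [sinh, exp_neg, exp_sub]
    rw [sinh, exp_neg, exp_sub] at h1
    have h5 := exp_ne_zero w
    have h6 := exp_ne_zero ζ
    field_simp at h1 ⊢
    have h7 : exp w ^ 2 - exp ζ ^ 2 ≠ 0 := by
      intro h8; apply h1; rw [h8, zero_div]
    field_simp
    ring
  have hHζ : H ζ = h ζ := by simp [hH]
  rw [← hHζ, ← lineInt_sub_lineInt_inv_sinh (H := H) (N := max N (|ζ.re| + 1)) hs
    (DifferentiableOn.smul (by fun_prop) hd)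
    (ha.trans_le e1) e2 e3 (e4.trans_lt hb) (by linarith) (by linarith)]
  · congr 1 <;> refine lineInt_congr fun w hw => hKH w ?_ ?_
    · rintro rfl; linarith
    · rw [sub_im, abs_lt]; constructor <;> linarith
    · rintro rfl; linarith
    · rw [sub_im, abs_lt]; constructor <;> linarith
  · intro w h1 h2 h3
    rw [← hKH w]
    · exact hbd w (by linarith) (by linarith) ((le_max_left _ _).trans h3)
    · rintro rfl
      have := (le_max_right N (|w.re| + 1)).trans h3
      linarith
    · rw [sub_im, abs_lt]; constructor <;> linarith

end Strip

/-! ### Sectors and the class `H₀^∞` -/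

theorem exp_mem_sector {φ : ℝ} (hφ : φ ≤ Real.pi) {w : ℂ} (hw : |w.im| < φ) :
    exp w ∈ sector φ := by
  refine ⟨exp_ne_zero w, ?_⟩
  rw [← log_im, log_exp]
  · exact hw
  · linarith [(abs_lt.1 hw).1]
  · linarith [(abs_lt.1 hw).2]

theorem exists_exp_eq_of_mem_sector {φ : ℝ} {z : ℂ} (hz : z ∈ sector φ) :
    ∃ w : ℂ, |w.im| < φ ∧ exp w = z :=
  ⟨log z, by rw [log_im]; exact hz.2, exp_log hz.1⟩

theorem sector_mono {φ ψ : ℝ} (h : φ ≤ ψ) : sector φ ⊆ sector ψ :=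
  fun _ hz => ⟨hz.1, hz.2.trans_le h⟩

/-- Unlike a bound on `arg`, this inequality is a closed condition, so it passes to the closure. It
reduces membership of `exp w` outside the closed sector to comparing cosines. -/
theorem cos_mul_norm_le_re_of_mem_closure_sector {ω : ℝ} (hω : ω ≤ Real.pi) {z : ℂ}
    (hz : z ∈ closure (sector ω)) : Real.cos ω * ‖z‖ ≤ z.re := by
  have hcl : IsClosed {z : ℂ | Real.cos ω * ‖z‖ ≤ z.re} :=
    isClosed_le (by fun_prop) continuous_re
  refine closure_minimal (fun z hz => ?_) hcl hz
  have h1 : Real.cos ω ≤ Real.cos z.arg := by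
    rw [← Real.cos_abs z.arg]
    exact Real.cos_le_cos_of_nonneg_of_le_pi (abs_nonneg _) hω hz.2.le
  rw [mem_ofPred_eq, ← norm_mul_cos_arg z, mul_comm]
  gcongr

theorem exp_notMem_closure_sector {ω : ℝ} (hω : ω ≤ Real.pi) {w : ℂ}
    (hw : Real.cos w.im < Real.cos ω) : exp w ∉ closure (sector ω) := by
  intro h
  have := cos_mul_norm_le_re_of_mem_closure_sector hω h
  rw [norm_exp, exp_re, mul_comm] at this
  exact absurd (le_of_mul_le_mul_left this (Real.exp_pos _)) (not_le.2 hw)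

theorem cos_lt_cos_of_lt_of_lt {ω y : ℝ} (h0 : 0 ≤ ω) (h1 : ω < y) (h2 : y < 2 * Real.pi - ω) :
    Real.cos y < Real.cos ω := by
  rcases le_total y Real.pi with h | h
  · exact Real.cos_lt_cos_of_nonneg_of_le_pi h0 h h1
  · rw [← Real.cos_two_pi_sub y]
    exact Real.cos_lt_cos_of_nonneg_of_le_pi h0 (by linarith) (by linarith)

theorem cos_lt_cos_of_abs {ω y : ℝ} (h0 : 0 ≤ ω) (h1 : ω < |y|) (h2 : |y| ≤ Real.pi) :
    Real.cos y < Real.cos ω := by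
  rw [← Real.cos_abs y]
  exact Real.cos_lt_cos_of_nonneg_of_le_pi h0 h2 h1

theorem neg_one_notMem_closure_sector {ω : ℝ} (h0 : 0 ≤ ω) (h1 : ω < Real.pi) :
    (-1 : ℂ) ∉ closure (sector ω) := by
  rw [← exp_pi_mul_I]
  exact exp_notMem_closure_sector h1.le
    (cos_lt_cos_of_lt_of_lt h0 (by simpa) (by simp; linarith))

/-- Translates the decay condition of `H₀^∞` into exponential decay in `Re w`, where `z = exp w`. -/
theorem min_rpow_eq_exp {r : ℝ} (hr : 0 < r) (s : ℝ) (hs : 0 < s) :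
    min (r ^ s) (r ^ (-s)) = Real.exp (-(s * |Real.log r|)) := by
  rw [Real.rpow_def_of_pos hr, Real.rpow_def_of_pos hr, ← Real.exp_monotone.map_min]
  congr 1
  rcases abs_cases (Real.log r) with ⟨h, h'⟩ | ⟨h, h'⟩
  · rw [h, min_eq_right (by nlinarith)]; ring
  · rw [h, min_eq_left (by nlinarith)]; ring

theorem mem_H0_iff {φ : ℝ} {f : ℂ → ℂ} : f ∈ H0 φ ↔ DifferentiableOn ℂ f (sector φ) ∧
    ∃ C s : ℝ, 0 < C ∧ 0 < s ∧
      ∀ z ∈ sector φ, ‖f z‖ ≤ C * Real.exp (-(s * |Real.log ‖z‖|)) := by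
  refine and_congr_right fun _ => ?_
  constructor <;> rintro ⟨C, s, hC, hs, h⟩ <;> refine ⟨C, s, hC, hs, fun z hz => ?_⟩
  · rw [← min_rpow_eq_exp (norm_pos_iff.2 hz.1) s hs]; exact h z hz
  · rw [min_rpow_eq_exp (norm_pos_iff.2 hz.1) s hs]; exact h z hz

theorem H0_exp_bound {φ : ℝ} (hφ : φ ≤ Real.pi) {f : ℂ → ℂ} (hf : f ∈ H0 φ) :
    ∃ C s : ℝ, 0 < C ∧ 0 < s ∧
      ∀ w : ℂ, |w.im| < φ → ‖f (exp w)‖ ≤ C * Real.exp (-(s * |w.re|)) := by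
  obtain ⟨-, C, s, hC, hs, h⟩ := mem_H0_iff.1 hf
  refine ⟨C, s, hC, hs, fun w hw => ?_⟩
  simpa [norm_exp] using h _ (exp_mem_sector hφ hw)

theorem H0_comp_exp {φ : ℝ} (hφ : φ ≤ Real.pi) {f : ℂ → ℂ} (hf : f ∈ H0 φ) :
    DifferentiableOn ℂ (fun w => f (exp w)) {w | |w.im| < φ} :=
  hf.1.comp (by fun_prop) fun _ hw => exp_mem_sector hφ hw

theorem H0_anti {φ ψ : ℝ} (h : φ ≤ ψ) {f : ℂ → ℂ} (hf : f ∈ H0 ψ) : f ∈ H0 φ := by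
  obtain ⟨hd, C, s, hC, hs, hb⟩ := hf
  exact ⟨hd.mono (sector_mono h), C, s, hC, hs, fun z hz => hb z (sector_mono h hz)⟩

theorem H0_congr {φ : ℝ} {f g : ℂ → ℂ} (hf : f ∈ H0 φ) (h : ∀ z ∈ sector φ, g z = f z) :
    g ∈ H0 φ := by
  obtain ⟨hd, C, s, hC, hs, hb⟩ := hf
  exact ⟨hd.congr h, C, s, hC, hs, fun z hz => by rw [h z hz]; exact hb z hz⟩

theorem H0_mul_of_bounded {φ : ℝ} {f b : ℂ → ℂ} (hf : f ∈ H0 φ)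
    (hd : DifferentiableOn ℂ b (sector φ)) {K : ℝ} (hb : ∀ z ∈ sector φ, ‖b z‖ ≤ K) :
    (fun z => f z * b z) ∈ H0 φ := by
  obtain ⟨hfd, C, s, hC, hs, hfb⟩ := mem_H0_iff.1 hf
  refine mem_H0_iff.2 ⟨hfd.mul hd, C * max K 1, s, by positivity, hs, fun z hz => ?_⟩
  rw [norm_mul, mul_right_comm]
  exact mul_le_mul (hfb z hz) ((hb z hz).trans (le_max_left _ _)) (norm_nonneg _) (by positivity)

theorem H0_bounded {φ : ℝ} {f : ℂ → ℂ} (hf : f ∈ H0 φ) : ∃ K, ∀ z ∈ sector φ, ‖f z‖ ≤ K := by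
  obtain ⟨-, C, s, hC, hs, hfb⟩ := mem_H0_iff.1 hf
  refine ⟨C, fun z hz => (hfb z hz).trans (mul_le_of_le_one_right hC.le ?_)⟩
  rw [Real.exp_le_one_iff, neg_nonpos]
  positivity

theorem H0_mul {φ : ℝ} {f g : ℂ → ℂ} (hf : f ∈ H0 φ) (hg : g ∈ H0 φ) :
    (fun z => f z * g z) ∈ H0 φ :=
  let ⟨_, hK⟩ := H0_bounded hg
  H0_mul_of_bounded hf hg.1 hK

theorem H0_mul_const {φ : ℝ} {f : ℂ → ℂ} (hf : f ∈ H0 φ) (c : ℂ) :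
    (fun z => f z * c) ∈ H0 φ :=
  H0_mul_of_bounded hf (differentiableOn_const c) fun _ _ => le_rfl

theorem H0_add {φ : ℝ} {f g : ℂ → ℂ} (hf : f ∈ H0 φ) (hg : g ∈ H0 φ) :
    (fun z => f z + g z) ∈ H0 φ := by
  obtain ⟨hfd, C, s, hC, hs, hfb⟩ := mem_H0_iff.1 hf
  obtain ⟨hgd, C', s', hC', hs', hgb⟩ := mem_H0_iff.1 hg
  refine mem_H0_iff.2 ⟨hfd.add hgd, C + C', min s s', by positivity, lt_min hs hs',
    fun z hz => ?_⟩
  rw [add_mul]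
  refine (norm_add_le _ _).trans (add_le_add ((hfb z hz).trans ?_) ((hgb z hz).trans ?_))
  · gcongr; exact min_le_left _ _
  · gcongr; exact min_le_right _ _

/-! ### The Cauchy kernel in logarithmic coordinates -/

/-- The kernel `dz / (z - a)` in the coordinates `z = exp w`, `a = exp ζ`. -/
def cauchyKernel (w ζ : ℂ) : ℂ := exp w / (exp w - exp ζ)

/-- The kernel is `1 / (1 - r e^{iα})` with `r > 0` and `cos α ≤ cos δ`, and `|1 - r e^{iα}|² = 1 -
2 r cos α + r² ≥ (r - cos δ)² + sin² δ`. -/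
theorem norm_cauchyKernel_le {w ζ : ℂ} {δ : ℝ} (h0 : 0 < δ) (h1 : δ < Real.pi)
    (h : Real.cos (w - ζ).im ≤ Real.cos δ) : ‖cauchyKernel w ζ‖ ≤ (Real.sin δ)⁻¹ := by
  have hsin := Real.sin_pos_of_pos_of_lt_pi h0 h1
  have hk : cauchyKernel w ζ = (1 - exp (ζ - w))⁻¹ := by
    rw [cauchyKernel, exp_sub]
    field_simp [exp_ne_zero w]
  rw [hk, norm_inv]
  gcongr
  refine le_of_sq_le_sq ?_ (norm_nonneg _)
  rw [← normSq_eq_norm_sq, normSq_apply]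
  simp only [sub_re, one_re, exp_re, sub_im, one_im, exp_im]
  have hc : Real.cos (ζ.im - w.im) ≤ Real.cos δ := by
    rw [← Real.cos_neg]; simpa using h
  set r := Real.exp (ζ.re - w.re)
  have hr : 0 < r := Real.exp_pos _
  have e1 : r ^ 2 * Real.sin (ζ.im - w.im) ^ 2 = r ^ 2 - r ^ 2 * Real.cos (ζ.im - w.im) ^ 2 := by
    rw [Real.sin_sq]; ring
  have e2 := Real.sin_sq_add_cos_sq δ
  nlinarith [mul_le_mul_of_nonneg_left hc hr.le, sq_nonneg (r - Real.cos δ)]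

theorem norm_cauchyKernel_le_two {w ζ : ℂ} (h : 1 ≤ |w.re - ζ.re|) :
    ‖cauchyKernel w ζ‖ ≤ 2 := by
  have he : ∀ x y : ℝ, y + 1 ≤ x → 2 * Real.exp y ≤ Real.exp x := by
    intro x y hxy
    calc 2 * Real.exp y ≤ Real.exp 1 * Real.exp y := by
          gcongr; linarith [Real.add_one_le_exp 1]
      _ = Real.exp (1 + y) := (Real.exp_add _ _).symm
      _ ≤ Real.exp x := by gcongr; linarith
  have h1 := norm_sub_norm_le (exp w) (exp ζ)
  have h2 := norm_sub_norm_le (exp ζ) (exp w)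
  rw [norm_sub_rev (exp ζ)] at h2
  simp only [norm_exp] at h1 h2
  have hw := Real.exp_pos w.re
  have hz := Real.exp_pos ζ.re
  have key : Real.exp w.re ≤ 2 * ‖exp w - exp ζ‖ ∧ 0 < ‖exp w - exp ζ‖ := by
    rcases le_abs'.1 h with h | h
    · have := he ζ.re w.re (by linarith)
      constructor <;> linarith
    · have := he w.re ζ.re (by linarith)
      constructor <;> linarith
  rw [cauchyKernel, norm_div, norm_exp, div_le_iff₀ key.2]
  exact key.1

/-- Since `-1 = exp (πi)`, the functions `z/(1+z)` and `1/(1+z)` are instances of the Cauchy kernel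
and inherit its bounds. -/
theorem div_one_add_exp (w : ℂ) : exp w / (1 + exp w) = cauchyKernel w (Real.pi * I) := by
  rw [cauchyKernel, exp_pi_mul_I]; ring

theorem inv_one_add_exp (w : ℂ) : (1 + exp w)⁻¹ = cauchyKernel (Real.pi * I) w := by
  rw [cauchyKernel, exp_pi_mul_I, inv_eq_one_div, ← neg_div_neg_eq]; ring

theorem one_add_ne_zero {φ : ℝ} (hφ : φ ≤ Real.pi) {z : ℂ} (hz : z ∈ sector φ) : 1 + z ≠ 0 := by
  intro h
  have : z = -1 := by linear_combination h
  have h2 := hz.2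
  rw [this, arg_neg_one, abs_of_pos Real.pi_pos] at h2
  linarith

theorem norm_div_one_add_le {φ : ℝ} (h0 : 0 < φ) (hφ : φ < Real.pi) {z : ℂ} (hz : z ∈ sector φ) :
    ‖z / (1 + z)‖ ≤ (Real.sin φ)⁻¹ ∧ ‖(1 + z)⁻¹‖ ≤ (Real.sin φ)⁻¹ := by
  obtain ⟨w, hw, rfl⟩ := exists_exp_eq_of_mem_sector hz
  have hc : -Real.cos w.im ≤ -Real.cos φ := by
    rw [neg_le_neg_iff, ← Real.cos_abs w.im]
    exact Real.cos_le_cos_of_nonneg_of_le_pi (abs_nonneg _) hφ.le hw.le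
  rw [div_one_add_exp, inv_one_add_exp, ← Real.sin_pi_sub]
  constructor <;> refine norm_cauchyKernel_le (by linarith) (by linarith) ?_ <;>
    rw [Real.cos_pi_sub]
  · simpa [Real.cos_sub_pi] using hc
  · simpa [Real.cos_pi_sub] using hc

theorem norm_tau_exp_le {w : ℂ} {c : ℝ} (h1 : ‖exp w / (1 + exp w)‖ ≤ c)
    (h2 : ‖(1 + exp w)⁻¹‖ ≤ c) : ‖tau (exp w)‖ ≤ c ^ 2 * Real.exp (-(1 * |w.re|)) := by
  have hc : 0 ≤ c := (norm_nonneg _).trans h1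
  have e1 : tau (exp w) = (exp w / (1 + exp w)) ^ 2 * exp (-w) := by
    rw [tau, exp_neg]
    field_simp [exp_ne_zero w]
  have e2 : tau (exp w) = ((1 + exp w)⁻¹) ^ 2 * exp w := by
    rw [tau, inv_pow, mul_comm, div_eq_mul_inv]
  rcases abs_cases w.re with ⟨h, -⟩ | ⟨h, -⟩
  · rw [e1, norm_mul, norm_pow, norm_exp, h, one_mul, neg_re]
    gcongr
  · rw [e2, norm_mul, norm_pow, norm_exp, h, one_mul, neg_neg]
    gcongr

theorem differentiableOn_inv_one_add {φ : ℝ} (hφ : φ ≤ Real.pi) :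
    DifferentiableOn ℂ (fun z : ℂ => (1 + z)⁻¹) (sector φ) :=
  DifferentiableOn.inv (by fun_prop) fun _ hz => one_add_ne_zero hφ hz

theorem tau_mem_H0 {φ : ℝ} (h0 : 0 < φ) (hφ : φ < Real.pi) : tau ∈ H0 φ := by
  have hsin := Real.sin_pos_of_pos_of_lt_pi h0 hφ
  refine mem_H0_iff.2 ⟨?_, (Real.sin φ)⁻¹ ^ 2, 1, by positivity, one_pos, fun z hz => ?_⟩
  · exact DifferentiableOn.div (by fun_prop) (by fun_prop) fun z hz =>
      pow_ne_zero 2 (one_add_ne_zero hφ.le hz)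
  · have := norm_div_one_add_le h0 hφ hz
    obtain ⟨w, hw, rfl⟩ := exists_exp_eq_of_mem_sector hz
    rw [norm_exp, Real.log_exp]
    exact norm_tau_exp_le this.1 this.2

theorem H0_mul_inv_one_add {φ : ℝ} (h0 : 0 < φ) (hφ : φ < Real.pi) {f : ℂ → ℂ} (hf : f ∈ H0 φ) :
    (fun z => f z * (1 + z)⁻¹) ∈ H0 φ :=
  H0_mul_of_bounded hf (differentiableOn_inv_one_add hφ.le) fun _ hz =>
    (norm_div_one_add_le h0 hφ hz).2

/-! ### The elementary calculus of an abstract sectorial resolvent family -/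

section PseudoResolvent

variable {B : Type*} [NormedRing B] [NormedAlgebra ℂ B]

/-- `R` satisfies the resolvent identity and the sectorial estimate outside the closed sector
of half-angle `ω`. -/
structure IsSectResolvent (R : ℂ → B) (ω M : ℝ) : Prop where
  pos : 0 < ω
  lt_pi : ω < Real.pi
  identity : ∀ z w : ℂ, z ∉ closure (sector ω) → w ∉ closure (sector ω) →
    R z - R w = (w - z) • (R z * R w)
  bound : ∀ z : ℂ, z ∉ closure (sector ω) → ‖z • R z‖ ≤ M

variable {R : ℂ → B} {ω M : ℝ}

/-- Holomorphy follows from the resolvent identity alone: it gives continuity first, and then the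
limit of the difference quotients. -/
theorem IsSectResolvent.hasDerivAt (hR : IsSectResolvent R ω M) {z : ℂ}
    (hz : z ∉ closure (sector ω)) : HasDerivAt R (-(R z * R z)) z := by
  have hU : (closure (sector ω))ᶜ ∈ 𝓝 z := isClosed_closure.isOpen_compl.mem_nhds hz
  have hcont : ContinuousAt R z := by
    rw [ContinuousAt, tendsto_iff_norm_sub_tendsto_zero]
    have hlim : Tendsto (fun w => ‖z - w‖ * (2 * ‖R z‖ * ‖R z‖)) (𝓝 z) (𝓝 0) := by
      have : Continuous fun w => ‖z - w‖ * (2 * ‖R z‖ * ‖R z‖) := by fun_prop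
      simpa using this.tendsto z
    -- Close to `z` the identity bounds `R w` in terms of itself with a factor below `1/2`, which
    -- can be absorbed to give `‖R w‖ ≤ 2 ‖R z‖`.
    have hsmall : ∀ᶠ w in 𝓝 z, ‖z - w‖ * ‖R z‖ < 1 / 2 := by
      have : Continuous fun w => ‖z - w‖ * ‖R z‖ := by fun_prop
      exact this.continuousAt.eventually_lt continuousAt_const (by simp)
    refine squeeze_zero' (.of_forall fun _ => norm_nonneg _) ?_ hlim
    filter_upwards [hU, hsmall] with w hw hs
    have h1 : ‖R w - R z‖ ≤ ‖z - w‖ * (‖R w‖ * ‖R z‖) := by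
      rw [hR.identity w z hw hz, norm_smul]
      gcongr
      exact norm_mul_le _ _
    have h2 : ‖R w‖ ≤ 2 * ‖R z‖ := by
      have := norm_sub_norm_le (R w) (R z)
      nlinarith [norm_nonneg (R w)]
    refine h1.trans ?_
    gcongr
  rw [hasDerivAt_iff_tendsto_slope]
  have hlim : Tendsto (fun w => -(R w * R z)) (𝓝[≠] z) (𝓝 (-(R z * R z))) :=
    ((hcont.mul continuousAt_const).neg).tendsto.mono_left nhdsWithin_le_nhds
  refine hlim.congr' ?_
  filter_upwards [self_mem_nhdsWithin, mem_nhdsWithin_of_mem_nhds hU] with w hne hw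
  rw [slope_def_module, hR.identity w z hw hz, smul_smul, ← neg_sub w z, mul_neg,
    inv_mul_cancel₀ (sub_ne_zero.2 hne), neg_one_smul]

theorem IsSectResolvent.differentiableOn (hR : IsSectResolvent R ω M) :
    DifferentiableOn ℂ R (closure (sector ω))ᶜ :=
  fun _ hz => (hR.hasDerivAt hz).differentiableAt.differentiableWithinAt

theorem IsSectResolvent.exp_notMem (hR : IsSectResolvent R ω M) {w : ℂ} (h1 : ω < |w.im|)
    (h2 : |w.im| ≤ Real.pi) : exp w ∉ closure (sector ω) :=
  exp_notMem_closure_sector hR.lt_pi.le (cos_lt_cos_of_abs hR.pos.le h1 h2)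

/-- This strip crosses height `π`, the negative real axis, which is needed for the contour around
`-1` in `IsSectResolvent.contourCalc_tau`. -/
theorem IsSectResolvent.exp_notMem' (hR : IsSectResolvent R ω M) {w : ℂ} (h1 : ω < w.im)
    (h2 : w.im < 2 * Real.pi - ω) : exp w ∉ closure (sector ω) :=
  exp_notMem_closure_sector hR.lt_pi.le (cos_lt_cos_of_lt_of_lt hR.pos.le h1 h2)

theorem IsSectResolvent.neg_one_notMem (hR : IsSectResolvent R ω M) :
    (-1 : ℂ) ∉ closure (sector ω) := neg_one_notMem_closure_sector hR.pos.le hR.lt_pi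

/-- The integrand of the elementary calculus in the coordinate `w = log z`. -/
def expIntegrand (R : ℂ → B) (f : ℂ → ℂ) (w : ℂ) : B := (f (exp w) * exp w) • R (exp w)

/-- The elementary calculus, as a difference of integrals over two horizontal lines in the
coordinate `w = log z`. -/
def contourCalc (R : ℂ → B) (θ : ℝ) (f : ℂ → ℂ) : B :=
  (2 * Real.pi * I)⁻¹ • (lineInt (expIntegrand R f) (-θ) - lineInt (expIntegrand R f) θ)

theorem IsSectResolvent.norm_expIntegrand_le (hR : IsSectResolvent R ω M) {f : ℂ → ℂ} {w : ℂ}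
    (hw : exp w ∉ closure (sector ω)) : ‖expIntegrand R f w‖ ≤ M * ‖f (exp w)‖ := by
  rw [expIntegrand, mul_smul, norm_smul, mul_comm]
  gcongr
  exact hR.bound _ hw

theorem IsSectResolvent.differentiableOn_expIntegrand (hR : IsSectResolvent R ω M) {φ : ℝ}
    (hφ : φ ≤ Real.pi) {f : ℂ → ℂ} (hf : DifferentiableOn ℂ f (sector φ)) :
    DifferentiableOn ℂ (expIntegrand R f) {w | ω < |w.im| ∧ |w.im| < φ} := by
  refine DifferentiableOn.smul (DifferentiableOn.mul ?_ differentiable_exp.differentiableOn) ?_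
  · exact hf.comp (by fun_prop) fun _ hw => exp_mem_sector hφ hw.2
  · exact hR.differentiableOn.comp differentiable_exp.differentiableOn fun w hw => hR.exp_notMem hw.1 (hw.2.le.trans hφ)

theorem IsSectResolvent.M_nonneg (hR : IsSectResolvent R ω M) : 0 ≤ M :=
  (norm_nonneg _).trans (hR.bound _ hR.neg_one_notMem)

theorem IsSectResolvent.exists_bound_expIntegrand (hR : IsSectResolvent R ω M) {φ : ℝ}
    (hφ : φ ≤ Real.pi) {f : ℂ → ℂ} (hf : f ∈ H0 φ) :
    ∃ C s : ℝ, 0 < s ∧ ∀ w : ℂ, ω < |w.im| → |w.im| < φ →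
      ‖expIntegrand R f w‖ ≤ C * Real.exp (-(s * |w.re|)) := by
  obtain ⟨C, s, hC, hs, hb⟩ := H0_exp_bound hφ hf
  refine ⟨M * C, s, hs, fun w h1 h2 => ?_⟩
  refine (hR.norm_expIntegrand_le (hR.exp_notMem h1 (h2.le.trans hφ))).trans ?_
  rw [mul_assoc]
  exact mul_le_mul_of_nonneg_left (hb w h2) hR.M_nonneg

theorem IsSectResolvent.integrable_expIntegrand (hR : IsSectResolvent R ω M) {φ : ℝ}
    (hφ : φ ≤ Real.pi) {f : ℂ → ℂ} (hf : f ∈ H0 φ) {y : ℝ} (h1 : ω < |y|) (h2 : |y| < φ) :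
    Integrable fun x : ℝ => expIntegrand R f (x + y * I) := by
  obtain ⟨C, s, hs, hb⟩ := hR.exists_bound_expIntegrand hφ hf
  refine integrable_line (N := 0) hs le_rfl le_rfl
    ((hR.differentiableOn_expIntegrand hφ hf.1).continuousOn.mono fun w hw => ?_)
    fun w h3 h4 _ => hb w ?_ ?_
  · rw [mem_ofPred_eq, le_antisymm hw.2 hw.1]; exact ⟨h1, h2⟩
  · rwa [le_antisymm h4 h3]
  · rwa [le_antisymm h4 h3]

theorem expIntegrand_congr {φ : ℝ} (hφ : φ ≤ Real.pi) {f g : ℂ → ℂ}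
    (h : ∀ z ∈ sector φ, f z = g z) {w : ℂ} (hw : |w.im| < φ) :
    expIntegrand R f w = expIntegrand R g w := by
  rw [expIntegrand, expIntegrand, h _ (exp_mem_sector hφ hw)]

theorem contourCalc_congr {φ θ : ℝ} (hφ : φ ≤ Real.pi) {f g : ℂ → ℂ}
    (h : ∀ z ∈ sector φ, f z = g z) (hθ : |θ| < φ) : contourCalc R θ f = contourCalc R θ g := by
  rw [contourCalc, contourCalc,
    lineInt_congr (y := -θ) fun w hw => expIntegrand_congr (R := R) hφ h (by rwa [hw, abs_neg]),
    lineInt_congr (y := θ) fun w hw => expIntegrand_congr (R := R) hφ h (by rwa [hw])]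

theorem IsSectResolvent.contourCalc_eq (hR : IsSectResolvent R ω M) {φ : ℝ}
    (hφ : φ ≤ Real.pi) {f : ℂ → ℂ} (hf : f ∈ H0 φ) {θ θ' : ℝ} (h1 : ω < θ) (h2 : θ < φ)
    (h1' : ω < θ') (h2' : θ' < φ) : contourCalc R θ f = contourCalc R θ' f := by
  wlog h : θ ≤ θ' generalizing θ θ'
  · exact (this h1' h2' h1 h2 (le_of_not_ge h)).symm
  have hω := hR.pos
  obtain ⟨C, s, hs, hb⟩ := hR.exists_bound_expIntegrand hφ hf
  have hd := hR.differentiableOn_expIntegrand hφ hf.1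
  have e1 : ∀ w : ℂ, θ ≤ w.im → w.im ≤ θ' → ω < |w.im| ∧ |w.im| < φ := by
    intro w h3 h4
    rw [abs_of_pos (by linarith)]
    constructor <;> linarith
  have e2 : ∀ w : ℂ, -θ' ≤ w.im → w.im ≤ -θ → ω < |w.im| ∧ |w.im| < φ := by
    intro w h3 h4
    rw [abs_of_neg (by linarith)]
    constructor <;> linarith
  rw [contourCalc, contourCalc,
    lineInt_shift (N := 0) h hs (hd.mono fun w hw => e1 w hw.1 hw.2)
      fun w h3 h4 _ => hb w (e1 w h3 h4).1 (e1 w h3 h4).2,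
    lineInt_shift (N := 0) (neg_le_neg h) hs (hd.mono fun w hw => e2 w hw.1 hw.2)
      fun w h3 h4 _ => hb w (e2 w h3 h4).1 (e2 w h3 h4).2]

theorem IsSectResolvent.contourCalc_add (hR : IsSectResolvent R ω M) {φ : ℝ}
    (hφ : φ ≤ Real.pi) {f g : ℂ → ℂ} (hf : f ∈ H0 φ) (hg : g ∈ H0 φ) {θ : ℝ}
    (h1 : ω < θ) (h2 : θ < φ) :
    contourCalc R θ (fun z => f z + g z) = contourCalc R θ f + contourCalc R θ g := by
  have hθ : |θ| = θ := abs_of_pos (hR.pos.trans h1)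
  have key : ∀ y : ℝ, |y| = θ → lineInt (expIntegrand R fun z => f z + g z) y =
      lineInt (expIntegrand R f) y + lineInt (expIntegrand R g) y := by
    intro y hy
    rw [← lineInt_add (hR.integrable_expIntegrand hφ hf (by rwa [hy]) (by rwa [hy]))
      (hR.integrable_expIntegrand hφ hg (by rwa [hy]) (by rwa [hy]))]
    refine lineInt_congr fun w _ => ?_
    simp only [expIntegrand]
    module
  rw [contourCalc, contourCalc, contourCalc, key _ (by rw [abs_neg, hθ]), key _ hθ]
  module

theorem contourCalc_mul_const (f : ℂ → ℂ) (c : ℂ) (θ : ℝ) :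
    contourCalc R θ (fun z => f z * c) = c • contourCalc R θ f := by
  have key : ∀ y : ℝ, lineInt (expIntegrand R fun z => f z * c) y =
      c • lineInt (expIntegrand R f) y := by
    intro y
    rw [← lineInt_smul]
    refine lineInt_congr fun w _ => ?_
    simp only [expIntegrand]
    module
  rw [contourCalc, contourCalc, key, key]
  module

theorem lineInt_add_two_pi (G : ℂ → B) (hG : ∀ w, G (w + 2 * Real.pi * I) = G w) (y : ℝ) :
    lineInt G (y + 2 * Real.pi) = lineInt G y := by
  rw [lineInt, lineInt]
  congr 1; ext x
  rw [← hG (x + y * I)]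
  congr 1; push_cast; ring

variable [CompleteSpace B]

theorem lineInt_const_mul {G : ℂ → B} {y : ℝ} (hG : Integrable fun x : ℝ => G (x + y * I))
    (b : B) : lineInt (fun w => b * G w) y = b * lineInt G y :=
  (ContinuousLinearMap.mul ℂ B b).integral_comp_comm hG

theorem lineInt_mul_const {G : ℂ → B} {y : ℝ} (hG : Integrable fun x : ℝ => G (x + y * I))
    (b : B) : lineInt (fun w => G w * b) y = lineInt G y * b :=
  ((ContinuousLinearMap.mul ℂ B).flip b).integral_comp_comm hG

/-- Cauchy's theorem on the strip corresponding to a sector. -/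
theorem lineInt_neg_eq_of_H0 {φ θ : ℝ} (hφ : φ ≤ Real.pi) (h0 : 0 ≤ θ) (h1 : θ < φ) {f : ℂ → ℂ}
    (hf : f ∈ H0 φ) {b : ℂ → ℂ}
    (hb : DifferentiableOn ℂ b {w | |w.im| ≤ θ}) {K N : ℝ}
    (hbK : ∀ w : ℂ, |w.im| ≤ θ → N ≤ |w.re| → ‖b w‖ ≤ K) :
    lineInt (fun w => f (exp w) * b w) (-θ) = lineInt (fun w => f (exp w) * b w) θ := by
  obtain ⟨C, s, hC, hs, hfb⟩ := H0_exp_bound hφ hf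
  refine lineInt_shift (C := C * max K 0) (N := N) (by linarith) hs ?_ fun w h2 h3 h4 => ?_
  · refine DifferentiableOn.mul ((H0_comp_exp hφ hf).mono fun w hw => ?_)
      (hb.mono fun w hw => abs_le.2 hw)
    exact (abs_le.2 hw).trans_lt h1
  · have h5 := abs_le.2 ⟨h2, h3⟩
    rw [norm_mul, mul_right_comm]
    exact mul_le_mul (hfb w (h5.trans_lt h1)) ((hbK w h5 h4).trans (le_max_left _ _))
      (norm_nonneg _) (by positivity)

/-- As `R(z) R(-1) = (R(-1) - R(z)) / (1+z)`, the integrand splits into a scalar function times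
`R(-1)` and the integrand for `f/(1+z)`. The scalar function is holomorphic in the sector, so by
Cauchy's theorem its two line integrals cancel. -/
theorem IsSectResolvent.contourCalc_mul_resolvent (hR : IsSectResolvent R ω M) {φ : ℝ}
    (hφ : φ < Real.pi) {f : ℂ → ℂ} (hf : f ∈ H0 φ) {θ : ℝ} (h1 : ω < θ) (h2 : θ < φ) :
    contourCalc R θ f * R (-1) = -contourCalc R θ (fun z => f z * (1 + z)⁻¹) ∧
    R (-1) * contourCalc R θ f = -contourCalc R θ (fun z => f z * (1 + z)⁻¹) := by
  have hω := hR.pos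
  have hφ0 : 0 < φ := by linarith
  have hθ : |θ| = θ := abs_of_pos (hω.trans h1)
  have hg := H0_mul_inv_one_add hφ0 hφ hf
  have hne : ∀ w : ℂ, |w.im| < φ → 1 + exp w ≠ 0 := fun w hw =>
    one_add_ne_zero hφ.le (exp_mem_sector hφ.le hw)
  have hid : ∀ w : ℂ, |w.im| = θ → expIntegrand R f w * R (-1) =
      (f (exp w) * (exp w / (1 + exp w))) • R (-1) -
        expIntegrand R (fun z => f z * (1 + z)⁻¹) w ∧
      R (-1) * expIntegrand R f w = (f (exp w) * (exp w / (1 + exp w))) • R (-1) -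
        expIntegrand R (fun z => f z * (1 + z)⁻¹) w := by
    intro w hw
    have hout := hR.exp_notMem (by rwa [hw]) (by rw [hw]; linarith)
    have h3 := hne w (by rwa [hw])
    have h4 := hR.identity _ _ hout hR.neg_one_notMem
    have h5 := hR.identity _ _ hR.neg_one_notMem hout
    have h6 : R (exp w) * R (-1) = (1 + exp w)⁻¹ • (R (-1) - R (exp w)) := by
      rw [← neg_sub (R (exp w)) (R (-1)), h4, ← neg_smul, smul_smul,
        show (1 + exp w)⁻¹ * -(-1 - exp w) = 1 by field_simp; ring, one_smul]
    have h7 : R (-1) * R (exp w) = (1 + exp w)⁻¹ • (R (-1) - R (exp w)) := by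
      rw [h5, smul_smul, show (1 + exp w)⁻¹ * (exp w - -1) = 1 by field_simp; ring, one_smul]
    constructor
    · simp only [expIntegrand]
      rw [smul_mul_assoc, h6]
      module
    · simp only [expIntegrand]
      rw [mul_smul_comm, h7]
      module
  have hint : ∀ y : ℝ, |y| = θ →
      Integrable fun x : ℝ => (fun w => (f (exp w) * (exp w / (1 + exp w))) • R (-1)) (x + y * I) := by
    intro y hy
    have e1 := (hR.integrable_expIntegrand hφ.le hf (y := y) (by rwa [hy]) (by rwa [hy])).mul_const
      (R (-1))
    have e2 := hR.integrable_expIntegrand hφ.le hg (y := y) (by rwa [hy]) (by rwa [hy])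
    refine (e1.add e2).congr (.of_forall fun x => ?_)
    simp only [Pi.add_apply]
    rw [(hid (x + y * I) (by simpa)).1, sub_add_cancel]
  have hzero : lineInt (fun w => (f (exp w) * (exp w / (1 + exp w))) • R (-1)) (-θ) =
      lineInt (fun w => (f (exp w) * (exp w / (1 + exp w))) • R (-1)) θ := by
    rw [lineInt_smul_const (fun w => f (exp w) * (exp w / (1 + exp w))),
      lineInt_smul_const (fun w => f (exp w) * (exp w / (1 + exp w))),
      lineInt_neg_eq_of_H0 (N := 0) hφ.le (by linarith) h2 hf (K := (Real.sin φ)⁻¹)]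
    · exact DifferentiableOn.div (by fun_prop) (by fun_prop) fun w hw => hne w (hw.trans_lt h2)
    · exact fun w hw _ => (norm_div_one_add_le hφ0 hφ (exp_mem_sector hφ.le (hw.trans_lt h2))).1
  have key : ∀ y : ℝ, |y| = θ → lineInt (expIntegrand R f) y * R (-1) =
      lineInt (fun w => (f (exp w) * (exp w / (1 + exp w))) • R (-1)) y -
        lineInt (expIntegrand R (fun z => f z * (1 + z)⁻¹)) y ∧
      R (-1) * lineInt (expIntegrand R f) y =
      lineInt (fun w => (f (exp w) * (exp w / (1 + exp w))) • R (-1)) y -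
        lineInt (expIntegrand R (fun z => f z * (1 + z)⁻¹)) y := by
    intro y hy
    have e1 := hR.integrable_expIntegrand hφ.le hf (y := y) (by rwa [hy]) (by rwa [hy])
    have e2 := hR.integrable_expIntegrand hφ.le hg (y := y) (by rwa [hy]) (by rwa [hy])
    rw [← lineInt_mul_const e1, ← lineInt_const_mul e1, ← lineInt_sub (hint y hy) e2]
    exact ⟨lineInt_congr fun w hw => (hid w (by rwa [hw])).1,
      lineInt_congr fun w hw => (hid w (by rwa [hw])).2⟩
  have k1 := key (-θ) (by rw [abs_neg, hθ])
  have k2 := key θ hθ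
  rw [hzero] at k1
  constructor
  · rw [contourCalc, contourCalc, smul_mul_assoc, sub_mul, k1.1, k2.1]
    module
  · rw [contourCalc, contourCalc, mul_smul_comm, mul_sub, k1.2, k2.2]
    module

/-- As `τ` is rational, the contour can be closed outside the sector, where `R` is holomorphic: the
height `-θ` is replaced by `2π - θ`, and the only singularity between the lines is at `πi`, that is,
`z = -1`. -/
theorem IsSectResolvent.contourCalc_tau (hR : IsSectResolvent R ω M) {φ : ℝ}
    (hφ : φ < Real.pi) {θ : ℝ} (h1 : ω < θ) (h2 : θ < φ) :
    contourCalc R θ tau = -R (-1) - R (-1) * R (-1) := by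
  have hω := hR.pos
  have hpi := Real.pi_pos
  have hφ0 : 0 < φ := by linarith
  have hθ : |θ| = θ := abs_of_pos (hω.trans h1)
  have hτ := tau_mem_H0 hφ0 hφ
  set T : B := -R (-1) with hT
  set h : ℂ → B := fun w => exp w • (R (exp w) * T) - T with hh
  set k : ℂ → B := fun w => (exp w / (exp w - exp (Real.pi * I))) • h w with hk
  set l : ℂ → B := fun w => tau (exp w) • T with hl
  -- The resolvent identity `R(z) = (1+z) R(z) T - T` lowers the double pole at `-1` to a simple one
  -- in `k`; the remainder `l` is scalar, and its integrals cancel by Cauchy's theorem inside the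
  -- sector.
  have hkl : ∀ w : ℂ, exp w ∉ closure (sector ω) → 1 + exp w ≠ 0 →
      expIntegrand R tau w = k w + l w := by
    intro w hout h3
    have h4 := hR.identity _ _ hout hR.neg_one_notMem
    have h6 : R (exp w) = (1 + exp w) • (R (exp w) * T) - T := by
      rw [hT, mul_neg, sub_neg_eq_add, smul_neg, ← neg_smul]
      rw [show -(1 + exp w) = -1 - exp w by ring, ← h4]
      abel
    simp only [hk, hl, hh, expIntegrand, exp_pi_mul_I]
    generalize R (exp w) * T = P at h6 ⊢
    rw [h6, tau, show exp w - -1 = 1 + exp w by ring]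
    match_scalars <;> field_simp
    ring
  have hlim : lineInt l (-θ) = lineInt l θ := by
    rw [hl, lineInt_smul_const (fun w => tau (exp w)), lineInt_smul_const (fun w => tau (exp w))]
    have := lineInt_neg_eq_of_H0 (b := fun _ => 1) (K := 1) (N := 0) hφ.le (by linarith) h2 hτ
      (differentiableOn_const _) (by simp)
    simp only [mul_one] at this
    rw [this]
  have hne : ∀ w : ℂ, 1 ≤ |w.re| → 1 + exp w ≠ 0 := by
    intro w hw h3
    have h4 : exp w = -1 := by linear_combination h3
    have h5 := congrArg norm h4
    rw [norm_exp, norm_neg, norm_one, Real.exp_eq_one_iff] at h5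
    rw [h5] at hw; simp at hw; linarith
  have hcauchy := lineInt_sub_lineInt_cauchy (h := h) (a := ω) (b := 2 * Real.pi - ω) (α := θ)
    (β := -θ + 2 * Real.pi) (C := M * 2 ^ 2 + 2 ^ 2 * ‖T‖) (s := 1) (N := 1) (ζ := Real.pi * I)
    one_pos ?_ h1 (by simp; linarith) (by simp; linarith) (by linarith) (by simp; linarith)
    (by simp; linarith) ?_
  · have hper : lineInt (expIntegrand R tau) (-θ + 2 * Real.pi) =
        lineInt (expIntegrand R tau) (-θ) := by
      refine lineInt_add_two_pi _ (fun w => ?_) _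
      simp only [expIntegrand, exp_periodic w]
    have hperl : lineInt l (-θ + 2 * Real.pi) = lineInt l (-θ) := by
      refine lineInt_add_two_pi _ (fun w => ?_) _
      simp only [hl, exp_periodic w]
    have hint : ∀ y : ℝ, |y| = θ → Integrable fun x : ℝ => expIntegrand R tau (x + y * I) :=
      fun y hy => hR.integrable_expIntegrand hφ.le hτ (by rwa [hy]) (by rwa [hy])
    have hintl : ∀ y : ℝ, |y| = θ → Integrable fun x : ℝ => l (x + y * I) := by
      intro y hy
      obtain ⟨C, s, hC, hs, hb⟩ := H0_exp_bound hφ.le hτ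
      refine Integrable.smul_const (integrable_line (G := fun w => tau (exp w)) (N := 0) hs le_rfl
        le_rfl ((H0_comp_exp hφ.le hτ).continuousOn.mono fun w hw => ?_) fun w h3 h4 _ => hb w ?_) T
      · rw [mem_ofPred_eq, le_antisymm hw.2 hw.1, hy]; exact h2
      · rwa [le_antisymm h4 h3, hy]
    have split : ∀ y : ℝ, |y| = θ → lineInt k y = lineInt (expIntegrand R tau) y - lineInt l y := by
      intro y hy
      rw [← lineInt_sub (hint y hy) (hintl y hy)]
      refine lineInt_congr fun w hw => ?_
      rw [hkl w (hR.exp_notMem (by rwa [hw, hy]) (by rw [hw, hy]; linarith))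
        (one_add_ne_zero hφ.le (exp_mem_sector hφ.le (by rwa [hw, hy]))), add_sub_cancel_right]
    have hkper : lineInt k (-θ + 2 * Real.pi) = lineInt k (-θ) := by
      refine lineInt_add_two_pi _ (fun w => ?_) _
      simp only [hk, hh, exp_periodic w]
    rw [hkper, split θ hθ, split (-θ) (by rw [abs_neg, hθ]), hlim] at hcauchy
    have hres : h (Real.pi * I) = -(-R (-1) - R (-1) * R (-1)) := by
      simp only [hh, hT, exp_pi_mul_I, mul_neg, smul_neg, neg_smul, one_smul]
      abel
    rw [hres] at hcauchy
    have h2pi : (2 * Real.pi * I : ℂ) ≠ 0 := two_pi_I_ne_zero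
    rw [contourCalc, inv_smul_eq_iff₀ h2pi, ← neg_inj, ← smul_neg, ← hcauchy]
    abel
  · refine DifferentiableOn.sub (DifferentiableOn.smul differentiable_exp.differentiableOn
      (DifferentiableOn.mul ?_ (differentiableOn_const _))) (differentiableOn_const _)
    exact hR.differentiableOn.comp differentiable_exp.differentiableOn fun w hw => hR.exp_notMem' hw.1 hw.2
  · intro w h3 h4 h5
    have hout := hR.exp_notMem' (w := w) (by linarith) (by linarith)
    have hτb : ‖tau (exp w)‖ ≤ 2 ^ 2 * Real.exp (-(1 * |w.re|)) := by
      refine norm_tau_exp_le ?_ ?_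
      · rw [div_one_add_exp]; exact norm_cauchyKernel_le_two (by simpa)
      · rw [inv_one_add_exp]; exact norm_cauchyKernel_le_two (by simpa using h5)
    -- The decay of `k` is not visible termwise, its kernel tending to `1` as `Re w → ∞`; it is read
    -- off from the decay of `τ` in this difference.
    have : k w = expIntegrand R tau w - l w := by
      rw [hkl w hout (hne w h5), add_sub_cancel_right]
    change ‖k w‖ ≤ _
    rw [this, add_mul]
    refine (norm_sub_le _ _).trans (add_le_add ?_ ?_)
    · rw [mul_assoc]
      exact (hR.norm_expIntegrand_le hout).trans (mul_le_mul_of_nonneg_left hτb hR.M_nonneg)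
    · rw [hl, norm_smul, mul_right_comm]
      gcongr

end PseudoResolvent

/-! ### Multiplicativity of the elementary calculus -/

theorem cos_sub_le_of_abs {x y a b : ℝ} (ha0 : 0 ≤ a) (ha : a ≤ Real.pi) (hb0 : 0 ≤ b)
    (hb : b ≤ Real.pi) (hx : |x| = a) (hy : |y| = b) : Real.cos (x - y) ≤ Real.cos (a - b) := by
  have h1 := Real.sin_nonneg_of_nonneg_of_le_pi ha0 ha
  have h2 := Real.sin_nonneg_of_nonneg_of_le_pi hb0 hb
  have h3 := mul_nonneg h1 h2
  rcases (abs_eq ha0).1 hx with rfl | rfl <;> rcases (abs_eq hb0).1 hy with rfl | rfl <;>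
    simp only [Real.cos_sub, Real.cos_neg, Real.sin_neg] <;> linarith

theorem exp_ne_exp_of_abs_im_lt {w ζ : ℂ} (h : |w.im| < |ζ.im|) (hζ : |ζ.im| < Real.pi) :
    exp w ≠ exp ζ := by
  intro he
  have hw := abs_lt.1 (h.trans hζ)
  have hz := abs_lt.1 hζ
  rw [exp_inj_of_neg_pi_lt_of_le_pi hw.1 hw.2.le hz.1 hz.2.le he] at h
  exact lt_irrefl _ h

section PseudoResolvent

variable {B : Type*} [NormedRing B] [NormedAlgebra ℂ B] [CompleteSpace B]
  {R : ℂ → B} {ω M : ℝ}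

theorem H0_lineInt_cauchy {φ θ : ℝ} (hφ : φ ≤ Real.pi) (hθ : θ < φ) {g : ℂ → ℂ} (hg : g ∈ H0 φ)
    {ζ : ℂ} (hζ : |ζ.im| < θ) :
    lineInt (fun w => cauchyKernel w ζ * g (exp w)) (-θ) -
      lineInt (fun w => cauchyKernel w ζ * g (exp w)) θ = 2 * Real.pi * I * g (exp ζ) := by
  have hz := abs_lt.1 hζ
  obtain ⟨C, s, hC, hs, hb⟩ := H0_exp_bound hφ hg
  refine lineInt_sub_lineInt_cauchy (E := ℂ) (h := fun w => g (exp w)) (a := -φ) (b := φ)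
    (C := 2 * C) (N := |ζ.re| + 1) hs ((H0_comp_exp hφ hg).mono fun w hw => abs_lt.2 hw)
    (by linarith) hz.1 hz.2 hθ (by linarith) (by linarith) fun w h1 h2 h3 => ?_
  rw [norm_smul, mul_assoc]
  refine mul_le_mul ?_ (hb w ((abs_le.2 ⟨h1, h2⟩).trans_lt hθ)) (norm_nonneg _) zero_le_two
  refine norm_cauchyKernel_le_two ?_
  have := abs_sub_abs_le_abs_sub w.re ζ.re
  linarith

/-- The integral `∫ g(z) R(z) (z - a)⁻¹ dz` along the ray of angle `y`, with `a = exp ζ`. -/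
def cauchyTransform (R : ℂ → B) (g : ℂ → ℂ) (y : ℝ) (ζ : ℂ) : B :=
  lineInt (fun w => (cauchyKernel w ζ * g (exp w)) • R (exp w)) y

theorem H0_integrable_line {φ : ℝ} (hφ : φ ≤ Real.pi) {g : ℂ → ℂ} (hg : g ∈ H0 φ) {y : ℝ}
    (hy : |y| < φ) : Continuous (fun x : ℝ => g (exp (x + y * I))) ∧
      Integrable (fun x : ℝ => g (exp (x + y * I))) := by
  obtain ⟨C, s, hC, hs, hb⟩ := H0_exp_bound hφ hg
  have hc : Continuous (fun x : ℝ => g (exp (x + y * I))) :=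
    continuous_line (G := fun w => g (exp w)) (H0_comp_exp hφ hg).continuousOn
      fun w hw => by rw [← hw] at hy; exact hy
  exact ⟨hc, integrable_of_exp_decay (N := 0) hc hs fun x _ => by
    simpa using hb (x + y * I) (by simpa)⟩

/-- The resolvent identity `R(a) R(z) = (R(a) - R(z)) / (z - a)` under the integral over `z`, the
two terms being separately integrable because the rays are a positive angle apart. -/
theorem IsSectResolvent.resolvent_mul_lineInt (hR : IsSectResolvent R ω M) {φ θ₁ θ₂ : ℝ}
    (hφ : φ ≤ Real.pi) (h1 : ω < θ₁) (h12 : θ₁ < θ₂) (h2 : θ₂ < φ) {g : ℂ → ℂ} (hg : g ∈ H0 φ)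
    {ζ : ℂ} (hζ : |ζ.im| = θ₁) {y : ℝ} (hy : |y| = θ₂) :
    R (exp ζ) * lineInt (expIntegrand R g) y =
      lineInt (fun w => cauchyKernel w ζ * g (exp w)) y • R (exp ζ) -
        cauchyTransform R g y ζ := by
  have hω := hR.pos
  have hne : ∀ w : ℂ, w.im = y → exp w ≠ exp ζ := fun w hw =>
    (exp_ne_exp_of_abs_im_lt (by rw [hw, hy, hζ]; exact h12) (by rw [hw, hy]; linarith)).symm
  have hout := hR.exp_notMem (w := ζ) (by rwa [hζ]) (by rw [hζ]; linarith)
  have hid : ∀ w : ℂ, w.im = y → R (exp ζ) * expIntegrand R g w =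
      (cauchyKernel w ζ * g (exp w)) • R (exp ζ) -
        (cauchyKernel w ζ * g (exp w)) • R (exp w) := by
    intro w hw
    have h3 := hR.identity _ _ hout
      (hR.exp_notMem (w := w) (by rw [hw, hy]; linarith) (by rw [hw, hy]; linarith))
    rw [← smul_sub, h3, smul_smul, expIntegrand, mul_smul_comm, cauchyKernel]
    congr 1
    have := sub_ne_zero.2 (hne w hw)
    field_simp
  obtain ⟨hgc, hgi⟩ := H0_integrable_line hφ hg (y := y) (by rwa [hy])
  have i1 := hR.integrable_expIntegrand hφ hg (y := y) (by rw [hy]; linarith) (by rwa [hy])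
  have i2 : Integrable fun x : ℝ =>
      (fun w => (cauchyKernel w ζ * g (exp w)) • R (exp ζ)) (x + y * I) := by
    refine Integrable.smul_const ?_ _
    refine hgi.bdd_mul (c := (Real.sin (θ₂ - θ₁))⁻¹) ?_ (.of_forall fun x => ?_)
    · refine Continuous.aestronglyMeasurable ?_
      exact Continuous.div (by fun_prop) (by fun_prop)
        fun x => sub_ne_zero.2 (hne _ (by simp))
    · refine norm_cauchyKernel_le (by linarith) (by linarith) ?_
      rw [sub_im]
      exact cos_sub_le_of_abs (by linarith) (by linarith) (by linarith) (by linarith)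
        (by simpa) hζ
  have i3 : Integrable fun x : ℝ =>
      (fun w => (cauchyKernel w ζ * g (exp w)) • R (exp w)) (x + y * I) := by
    refine (i2.sub (i1.const_mul (R (exp ζ)))).congr (.of_forall fun x => ?_)
    simp only [Pi.sub_apply]
    rw [hid _ (by simp), sub_sub_cancel]
  rw [← lineInt_const_mul i1, cauchyTransform, ← lineInt_smul_const, ← lineInt_sub i2 i3]
  exact lineInt_congr hid

/-- Fubini applies because the kernel is bounded by `1 / sin (θ₂ - θ₁)` on distinct rays, leaving a
product of integrable functions. The sign arises when the kernel `1/(z - a)` is read as a kernel in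
`a` instead of `z`. -/
theorem IsSectResolvent.fubini_cauchyTransform (hR : IsSectResolvent R ω M) {φ θ₁ θ₂ : ℝ}
    (hφ : φ ≤ Real.pi) (h1 : ω < θ₁) (h12 : θ₁ < θ₂) (h2 : θ₂ < φ) {f g : ℂ → ℂ} (hf : f ∈ H0 φ)
    (hg : g ∈ H0 φ) {y₁ y₂ : ℝ} (hy₁ : |y₁| = θ₁) (hy₂ : |y₂| = θ₂) :
    (Integrable fun x : ℝ =>
      (fun ζ => (f (exp ζ) * exp ζ) • cauchyTransform R g y₂ ζ) (x + y₁ * I)) ∧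
    lineInt (fun ζ => (f (exp ζ) * exp ζ) • cauchyTransform R g y₂ ζ) y₁ =
      lineInt (fun w => lineInt (fun ζ => f (exp ζ) * -cauchyKernel ζ w) y₁ •
        expIntegrand R g w) y₂ := by
  have hω := hR.pos
  have hne : ∀ ζ w : ℂ, ζ.im = y₁ → w.im = y₂ → exp ζ - exp w ≠ 0 := fun ζ w hz hw =>
    sub_ne_zero.2
      (exp_ne_exp_of_abs_im_lt (by rw [hw, hz, hy₁, hy₂]; exact h12) (by rw [hw, hy₂]; linarith))
  obtain ⟨hfc, hfi⟩ := H0_integrable_line hφ hf (y := y₁) (by rw [hy₁]; linarith)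
  have hGi := hR.integrable_expIntegrand hφ hg (y := y₂) (by rw [hy₂]; linarith) (by rwa [hy₂])
  have hGc : Continuous fun x : ℝ => expIntegrand R g (x + y₂ * I) :=
    continuous_line (hR.differentiableOn_expIntegrand hφ hg.1).continuousOn fun w hw => by
      rw [← hw] at hy₂
      exact ⟨by rw [hy₂]; linarith, by rwa [hy₂]⟩
  set Ψ : ℝ → ℝ → B := fun x₁ x₂ => (f (exp (x₁ + y₁ * I)) *
    -cauchyKernel (x₁ + y₁ * I) (x₂ + y₂ * I)) • expIntegrand R g (x₂ + y₂ * I) with hΨ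
  have hΨ' : ∀ x₁ x₂ : ℝ, Ψ x₁ x₂ = (f (exp (x₁ + y₁ * I)) * exp (x₁ + y₁ * I)) •
      ((cauchyKernel (x₂ + y₂ * I) (x₁ + y₁ * I) * g (exp (x₂ + y₂ * I))) •
        R (exp (x₂ + y₂ * I))) := by
    intro x₁ x₂
    simp only [hΨ, expIntegrand, cauchyKernel, smul_smul]
    congr 1
    have e1 := hne (x₁ + y₁ * I) (x₂ + y₂ * I) (by simp) (by simp)
    have e2 : exp (x₂ + y₂ * I) - exp (x₁ + y₁ * I) ≠ 0 := by rw [← neg_sub]; exact neg_ne_zero.2 e1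
    generalize exp (x₂ + y₂ * I) = b at *
    generalize exp (x₁ + y₁ * I) = a at *
    rw [← neg_sub b a, div_neg, neg_neg]
    ring
  have hΨi : Integrable (Function.uncurry Ψ) (volume.prod volume) := by
    have hprod := hfi.norm.mul_prod hGi.norm
    refine (hprod.const_mul (Real.sin (θ₂ - θ₁))⁻¹).mono' (Continuous.aestronglyMeasurable ?_)
      (.of_forall fun p => ?_)
    · refine Continuous.smul (Continuous.mul (hfc.comp continuous_fst) (Continuous.neg ?_))
        (hGc.comp continuous_snd)
      exact Continuous.div (by fun_prop) (by fun_prop)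
        fun p => hne _ _ (by simp) (by simp)
    · simp only [Function.uncurry, hΨ]
      rw [norm_smul, norm_mul, norm_neg, mul_comm ‖f _‖, mul_assoc]
      gcongr
      refine norm_cauchyKernel_le (by linarith) (by linarith) ?_
      rw [← Real.cos_neg (θ₂ - θ₁), neg_sub, sub_im]
      exact cos_sub_le_of_abs (by linarith) (by linarith) (by linarith) (by linarith)
        (by simpa) (by simpa)
  have hinner : ∀ x₁ : ℝ, ∫ x₂, Ψ x₁ x₂ =
      (fun ζ => (f (exp ζ) * exp ζ) • cauchyTransform R g y₂ ζ) (x₁ + y₁ * I) := by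
    intro x₁
    simp only [hΨ', integral_smul]
    rfl
  refine ⟨hΨi.integral_prod_left.congr (.of_forall hinner), ?_⟩
  calc _ = ∫ x₁, ∫ x₂, Ψ x₁ x₂ := by simp only [hinner]; rfl
    _ = ∫ x₂, ∫ x₁, Ψ x₁ x₂ := integral_integral_swap hΨi
    _ = _ := by simp only [hΨ, integral_smul_const]; rfl

/-- The contour for `g` is opened wider than that for `f`. A point `a` of the inner contour is
enclosed by the outer one, so `R(a)` times the integral for `g` yields `g(a) R(a)` and a remainder.
After exchanging integrals, the remainder contains the inner contour integral of `f` against a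
kernel with pole outside, which vanishes. -/
theorem IsSectResolvent.contourCalc_mul (hR : IsSectResolvent R ω M) {φ : ℝ}
    (hφ : φ ≤ Real.pi) {f g : ℂ → ℂ} (hf : f ∈ H0 φ) (hg : g ∈ H0 φ) {θ : ℝ} (h1 : ω < θ)
    (h2 : θ < φ) :
    contourCalc R θ (fun z => f z * g z) = contourCalc R θ f * contourCalc R θ g := by
  obtain ⟨θ₂, h12, h3⟩ := exists_between h2
  rw [hR.contourCalc_eq hφ hg h1 h2 (h1.trans h12) h3]
  have hω := hR.pos
  have hθ : |θ| = θ := abs_of_pos (by linarith)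
  have hθ' : |-θ| = θ := by rw [abs_neg, hθ]
  have hθ₂ : |θ₂| = θ₂ := abs_of_pos (by linarith)
  have hθ₂' : |-θ₂| = θ₂ := by rw [abs_neg, hθ₂]
  have h2pi : (2 * Real.pi * I : ℂ) ≠ 0 := two_pi_I_ne_zero
  have hfg := H0_mul hf hg
  have hid : ∀ ζ : ℂ, |ζ.im| = θ → expIntegrand R f ζ * contourCalc R θ₂ g =
      expIntegrand R (fun z => f z * g z) ζ - (2 * Real.pi * I)⁻¹ •
        ((f (exp ζ) * exp ζ) • cauchyTransform R g (-θ₂) ζ -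
          (f (exp ζ) * exp ζ) • cauchyTransform R g θ₂ ζ) := by
    intro ζ hζ
    have e1 := hR.resolvent_mul_lineInt hφ h1 h12 h3 hg hζ hθ₂
    have e2 := hR.resolvent_mul_lineInt hφ h1 h12 h3 hg hζ hθ₂'
    have e3 := H0_lineInt_cauchy hφ h3 hg (ζ := ζ) (by rwa [hζ])
    have e4 : R (exp ζ) * contourCalc R θ₂ g = g (exp ζ) • R (exp ζ) - (2 * Real.pi * I)⁻¹ •
        (cauchyTransform R g (-θ₂) ζ - cauchyTransform R g θ₂ ζ) := by
      rw [contourCalc, mul_smul_comm, mul_sub, e1, e2, sub_sub_sub_comm, ← sub_smul, e3, smul_sub,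
        smul_smul, inv_mul_cancel_left₀ h2pi]
    rw [expIntegrand, smul_mul_assoc, e4, expIntegrand]
    module
  have key : ∀ y : ℝ, |y| = θ → lineInt (expIntegrand R f) y * contourCalc R θ₂ g =
      lineInt (expIntegrand R (fun z => f z * g z)) y - (2 * Real.pi * I)⁻¹ •
        (lineInt (fun w => lineInt (fun ζ => f (exp ζ) * -cauchyKernel ζ w) y •
            expIntegrand R g w) (-θ₂) -
          lineInt (fun w => lineInt (fun ζ => f (exp ζ) * -cauchyKernel ζ w) y •
            expIntegrand R g w) θ₂) := by
    intro y hy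
    have i1 := hR.integrable_expIntegrand hφ hf (y := y) (by rwa [hy]) (by rwa [hy])
    have i2 := hR.integrable_expIntegrand hφ hfg (y := y) (by rwa [hy]) (by rwa [hy])
    obtain ⟨i3, e3⟩ := hR.fubini_cauchyTransform hφ h1 h12 h3 hf hg hy hθ₂
    obtain ⟨i4, e4⟩ := hR.fubini_cauchyTransform hφ h1 h12 h3 hf hg hy hθ₂'
    have i5 := (i4.sub i3).smul (2 * Real.pi * I : ℂ)⁻¹
    rw [← e3, ← e4, ← lineInt_sub i4 i3, ← lineInt_smul, ← lineInt_sub i2 i5,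
      ← lineInt_mul_const i1]
    exact lineInt_congr fun ζ hζ => hid ζ (by rwa [hζ])
  have hsym : ∀ y : ℝ, |y| = θ₂ →
      lineInt (fun w => lineInt (fun ζ => f (exp ζ) * -cauchyKernel ζ w) (-θ) •
        expIntegrand R g w) y =
      lineInt (fun w => lineInt (fun ζ => f (exp ζ) * -cauchyKernel ζ w) θ •
        expIntegrand R g w) y := by
    intro y hy
    refine lineInt_congr fun w hw => ?_
    rw [← hw] at hy
    rw [lineInt_neg_eq_of_H0 (N := |w.re| + 1) (K := 2) hφ (by linarith) h2 hf]
    · refine (DifferentiableOn.div differentiable_exp.differentiableOn (by fun_prop)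
        fun ζ hζ => sub_ne_zero.2 ?_).neg
      exact exp_ne_exp_of_abs_im_lt (by rw [hy]; exact lt_of_le_of_lt hζ h12) (by rw [hy]; linarith)
    · intro ζ _ hζ
      rw [norm_neg]
      refine norm_cauchyKernel_le_two ?_
      have := abs_sub_abs_le_abs_sub ζ.re w.re
      linarith
  rw [contourCalc, contourCalc, smul_mul_assoc, sub_mul, key _ hθ, key _ hθ', hsym _ hθ₂,
    hsym _ hθ₂', sub_sub_sub_cancel_right]

end PseudoResolvent

section Operators

variable {X : Type*} [NormedAddCommGroup X] [NormedSpace ℂ X]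

/-! ### Graphs of operators -/

theorem mem_graph_opMul {S T : X →ₗ.[ℂ] X} {x z : X} :
    (x, z) ∈ (opMul S T).graph ↔ ∃ y, (x, y) ∈ T.graph ∧ (y, z) ∈ S.graph := by
  simp only [LinearPMap.mem_graph_iff]
  constructor
  · rintro ⟨⟨x', hx'⟩, rfl, hz⟩
    obtain ⟨h, h'⟩ := mem_opMul_domain.1 hx'
    exact ⟨T ⟨x', h⟩, ⟨⟨x', h⟩, rfl, rfl⟩, ⟨_, h'⟩, rfl, hz⟩
  · rintro ⟨y, ⟨⟨x', h⟩, rfl, rfl⟩, ⟨y', h'⟩, rfl, rfl⟩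
    exact ⟨⟨x', mem_opMul_domain.2 ⟨h, h'⟩⟩, rfl, rfl⟩

theorem mem_graph_ofBdd {B : X →L[ℂ] X} {x y : X} : (x, y) ∈ (ofBdd B).graph ↔ y = B x := by
  rw [LinearPMap.mem_graph_iff]
  constructor
  · rintro ⟨x', rfl, h⟩
    exact h.symm
  · rintro rfl
    exact ⟨⟨x, trivial⟩, rfl, rfl⟩

theorem mem_graph_inverse_ofBdd {B : X →L[ℂ] X} (hB : Function.Injective B) {x y : X} :
    (x, y) ∈ (ofBdd B).inverse.graph ↔ B y = x := by
  have hker : LinearMap.ker (ofBdd B).toFun = ⊥ := by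
    rw [LinearMap.ker_eq_bot]
    intro a b hab
    exact Subtype.ext (hB hab)
  rw [LinearPMap.inverse_graph hker, Submodule.mem_map]
  constructor
  · rintro ⟨⟨a, b⟩, h, hab⟩
    obtain ⟨rfl, rfl⟩ : b = x ∧ a = y := by simpa using hab
    exact (mem_graph_ofBdd.1 h).symm
  · rintro rfl
    exact ⟨(y, B y), mem_graph_ofBdd.2 rfl, rfl⟩

/-! ### The resolvent of a sectorial operator -/

theorem opResolvent_spec {A : X →ₗ.[ℂ] X} {z : ℂ} (hz : z ∉ opSpectrum A) :
    IsBddInverse (affineOp A z (-1)) (opResolvent A z) := by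
  have h : ∃ B, IsBddInverse (affineOp A z (-1)) B := not_not.1 hz
  rw [opResolvent, bddInverse, dif_pos h]
  exact h.choose_spec

theorem opResolvent_mem {A : X →ₗ.[ℂ] X} {z : ℂ} (hz : z ∉ opSpectrum A) (x : X) :
    ∃ h : opResolvent A z x ∈ A.domain, z • opResolvent A z x - A ⟨opResolvent A z x, h⟩ = x := by
  obtain ⟨h, hx⟩ := (opResolvent_spec hz).1 x
  refine ⟨h, ?_⟩
  rw [sub_eq_add_neg, ← neg_one_smul ℂ (A _)]
  exact hx

theorem opResolvent_apply {A : X →ₗ.[ℂ] X} {z : ℂ} (hz : z ∉ opSpectrum A) (y : A.domain) :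
    opResolvent A z (z • (y : X) - A y) = y := by
  rw [sub_eq_add_neg, ← neg_one_smul ℂ (A _)]
  exact (opResolvent_spec hz).2 y

theorem opResolvent_sub {A : X →ₗ.[ℂ] X} {z w : ℂ} (hz : z ∉ opSpectrum A)
    (hw : w ∉ opSpectrum A) :
    opResolvent A z - opResolvent A w = (w - z) • (opResolvent A z * opResolvent A w) := by
  ext x
  obtain ⟨h, hx⟩ := opResolvent_mem hw x
  have h1 := opResolvent_apply hz ⟨_, h⟩
  have h2 : z • opResolvent A w x - A ⟨opResolvent A w x, h⟩ = x + (z - w) • opResolvent A w x := by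
    nth_rw 3 [← hx]
    module
  simp only [h2, map_add, map_smul] at h1
  change opResolvent A z x - opResolvent A w x = (w - z) • opResolvent A z (opResolvent A w x)
  linear_combination (norm := module) h1

theorem IsSect.exists_isSectResolvent {A : X →ₗ.[ℂ] X} {ω : ℝ} (hA : IsSect A ω) :
    ∃ M, IsSectResolvent (opResolvent A) ω M := by
  obtain ⟨h0, h1, -, hσ, M, hM⟩ := hA
  exact ⟨M, h0, h1, fun z w hz hw => opResolvent_sub (fun h => hz (hσ h)) (fun h => hw (hσ h)), hM⟩

/-- With `T = (1+A)⁻¹ = -R(-1)` the operator is `T - T² = A (1+A)⁻²`, a product of injective maps.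
-/
theorem injective_of_opResolvent {A : X →ₗ.[ℂ] X} (hinj : Function.Injective A)
    (h : (-1 : ℂ) ∉ opSpectrum A) : Function.Injective
      (-opResolvent A (-1) - opResolvent A (-1) * opResolvent A (-1) : X →L[ℂ] X) := by
  have hm := opResolvent_mem h
  generalize opResolvent A (-1) = S at hm ⊢
  have hS : ∀ y, S y = 0 → y = 0 := by
    intro y hy
    obtain ⟨hd, h2⟩ := hm y
    have h3 : A ⟨S y, hd⟩ = 0 := by
      rw [show (⟨S y, hd⟩ : A.domain) = 0 from Subtype.ext hy]
      exact map_zero A.toFun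
    rw [← h2, h3, hy, smul_zero, sub_zero]
  rw [injective_iff_map_eq_zero]
  intro x hx
  change -S x - S (S x) = 0 at hx
  have h1 : x + S x = 0 := hS _ (by rw [map_add, ← neg_eq_zero, neg_add, ← sub_eq_add_neg, hx])
  obtain ⟨hd, h2⟩ := hm x
  have h3 : A ⟨S x, hd⟩ = 0 := by
    linear_combination (norm := module) (-1 : ℂ) • h2 - h1
  exact hS x (congrArg Subtype.val (hinj (h3.trans (map_zero A.toFun).symm)))

end Operators

/-! ### Transfer of the abstract calculus to `A` -/

section Calculus

/-- The substitution `t = exp x`; its Jacobian supplies the missing modulus of the factor `exp w` in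
`expIntegrand`. -/
theorem integral_Ioi_eq_lineInt {B : Type*} [NormedRing B] [NormedAlgebra ℂ B] (R : ℂ → B)
    (f : ℂ → ℂ) (y : ℝ) :
    ∫ t in Ioi (0 : ℝ), (f (t * exp (y * I)) * exp (y * I)) • R (t * exp (y * I)) =
      lineInt (expIntegrand R f) y := by
  rw [← Real.range_exp, ← image_univ, integral_image_eq_integral_abs_deriv_smul MeasurableSet.univ
    (fun x _ => (Real.hasDerivAt_exp x).hasDerivWithinAt) Real.exp_injective.injOn,
    Measure.restrict_univ, lineInt]
  congr 1; ext x
  rw [expIntegrand, exp_add, ofReal_exp, abs_of_pos (Real.exp_pos x),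
    ← Complex.coe_smul (Real.exp x), ofReal_exp, smul_smul]
  congr 1; ring

variable {X : Type*} [NormedAddCommGroup X] [NormedSpace ℂ X] {A : X →ₗ.[ℂ] X} {ω φ : ℝ}

theorem elemCalc_eq_contourCalc (A : X →ₗ.[ℂ] X) (ω φ : ℝ) (f : ℂ → ℂ) :
    elemCalc A ω φ f = contourCalc (opResolvent A) ((ω + φ) / 2) f := by
  rw [contourCalc, ← integral_Ioi_eq_lineInt, ← integral_Ioi_eq_lineInt, ofReal_neg]
  rfl

theorem elemCalc_congr (h0 : 0 < ω) (hωφ : ω < φ) (hφ : φ ≤ Real.pi) {f g : ℂ → ℂ}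
    (h : ∀ z ∈ sector φ, f z = g z) : elemCalc A ω φ f = elemCalc A ω φ g := by
  rw [elemCalc_eq_contourCalc, elemCalc_eq_contourCalc]
  exact contourCalc_congr hφ h (by rw [abs_of_pos (by linarith)]; linarith)

theorem elemCalc_of_le (hA : IsSect A ω) {ψ : ℝ} (hωφ : ω < φ) (hφψ : φ ≤ ψ) (hψ : ψ ≤ Real.pi)
    {f : ℂ → ℂ} (hf : f ∈ H0 ψ) : elemCalc A ω φ f = elemCalc A ω ψ f := by
  obtain ⟨M, hR⟩ := hA.exists_isSectResolvent
  rw [elemCalc_eq_contourCalc, elemCalc_eq_contourCalc]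
  exact hR.contourCalc_eq hψ hf (by linarith) (by linarith) (by linarith) (by linarith)

theorem elemCalc_add (hA : IsSect A ω) (hωφ : ω < φ) (hφ : φ ≤ Real.pi) {f g : ℂ → ℂ}
    (hf : f ∈ H0 φ) (hg : g ∈ H0 φ) :
    elemCalc A ω φ (fun z => f z + g z) = elemCalc A ω φ f + elemCalc A ω φ g := by
  obtain ⟨M, hR⟩ := hA.exists_isSectResolvent
  simp only [elemCalc_eq_contourCalc]
  exact hR.contourCalc_add hφ hf hg (by linarith) (by linarith)

theorem elemCalc_mul_const (f : ℂ → ℂ) (c : ℂ) :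
    elemCalc A ω φ (fun z => f z * c) = c • elemCalc A ω φ f := by
  simp only [elemCalc_eq_contourCalc]
  exact contourCalc_mul_const f c _

variable [CompleteSpace X]

theorem elemCalc_mul (hA : IsSect A ω) (hωφ : ω < φ) (hφ : φ ≤ Real.pi) {f g : ℂ → ℂ}
    (hf : f ∈ H0 φ) (hg : g ∈ H0 φ) :
    elemCalc A ω φ (fun z => f z * g z) = elemCalc A ω φ f * elemCalc A ω φ g := by
  obtain ⟨M, hR⟩ := hA.exists_isSectResolvent
  simp only [elemCalc_eq_contourCalc]
  exact hR.contourCalc_mul hφ hf hg (by linarith) (by linarith)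

theorem elemCalc_mul_resolvent (hA : IsSect A ω) (hωφ : ω < φ) (hφ : φ < Real.pi) {f : ℂ → ℂ}
    (hf : f ∈ H0 φ) :
    elemCalc A ω φ f * -opResolvent A (-1) = elemCalc A ω φ (fun z => f z * (1 + z)⁻¹) ∧
    -opResolvent A (-1) * elemCalc A ω φ f = elemCalc A ω φ (fun z => f z * (1 + z)⁻¹) := by
  obtain ⟨M, hR⟩ := hA.exists_isSectResolvent
  have h := hR.contourCalc_mul_resolvent hφ hf (θ := (ω + φ) / 2) (by linarith) (by linarith)
  rw [elemCalc_eq_contourCalc, elemCalc_eq_contourCalc, mul_neg, neg_mul, h.1, h.2, neg_neg]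
  exact ⟨rfl, rfl⟩

theorem elemCalc_tau_injective (hA : IsSect A ω) (hinj : Function.Injective A) (hωφ : ω < φ)
    (hφ : φ < Real.pi) : Function.Injective (elemCalc A ω φ tau) := by
  obtain ⟨M, hR⟩ := hA.exists_isSectResolvent
  rw [elemCalc_eq_contourCalc, hR.contourCalc_tau hφ (by linarith) (by linarith)]
  exact injective_of_opResolvent hinj fun h => hR.neg_one_notMem (hA.2.2.2.1 h)

end Calculus

end HolCalc

namespace HolCalc

section Extended

variable {X : Type*} [NormedAddCommGroup X] [NormedSpace ℂ X] {A : X →ₗ.[ℂ] X} {ω φ : ℝ}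

/-! ### Regularisers -/

theorem BSect_anti {ψ : ℝ} (h : φ ≤ ψ) {f : ℂ → ℂ} (hf : f ∈ BSect ψ) : f ∈ BSect φ :=
  let ⟨n, hn⟩ := hf
  ⟨n, H0_anti h hn⟩

theorem BSect_mul {f g : ℂ → ℂ} (hf : f ∈ BSect φ) (hg : g ∈ BSect φ) :
    (fun z => f z * g z) ∈ BSect φ := by
  obtain ⟨n, hn⟩ := hf
  obtain ⟨m, hm⟩ := hg
  refine ⟨n + m, H0_congr (H0_mul hn hm) fun z _ => ?_⟩
  rw [pow_add]; ring

theorem tau_pow_mul_mem_H0 (h0 : 0 < φ) (hφ : φ < Real.pi) {f : ℂ → ℂ} {n m : ℕ} (h : n ≤ m)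
    (hf : (fun z => tau z ^ n * f z) ∈ H0 φ) : (fun z => tau z ^ m * f z) ∈ H0 φ := by
  induction m, h using Nat.le_induction with
  | base => exact hf
  | succ m _ ih =>
    refine H0_congr (H0_mul ih (tau_mem_H0 h0 hφ)) fun z _ => ?_
    rw [pow_succ]; ring

theorem tau_pow_succ_mem_H0 (h0 : 0 < φ) (hφ : φ < Real.pi) (n : ℕ) :
    (fun z => tau z ^ (n + 1)) ∈ H0 φ := by
  have := tau_pow_mul_mem_H0 (f := fun _ => 1) h0 hφ (Nat.succ_le_succ n.zero_le)
    (by simpa using tau_mem_H0 h0 hφ)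
  simpa using this

variable [CompleteSpace X]

theorem elemCalc_tau_pow_succ_injective (hA : IsSect A ω) (hinj : Function.Injective A)
    (hωφ : ω < φ) (hφ : φ < Real.pi) (n : ℕ) :
    Function.Injective (elemCalc A ω φ fun z => tau z ^ (n + 1)) := by
  have h0 := hA.1.trans hωφ
  have hτ := elemCalc_tau_injective hA hinj hωφ hφ
  induction n with
  | zero => simpa using hτ
  | succ n ih =>
    simp only [pow_succ _ (n + 1)]
    rw [elemCalc_mul hA hωφ hφ.le (tau_pow_succ_mem_H0 h0 hφ n) (tau_mem_H0 h0 hφ)]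
    exact ih.comp hτ

theorem exists_tau_pow_mem_Reg (hA : IsSect A ω) (hinj : Function.Injective A) (hωφ : ω < φ)
    (hφ : φ < Real.pi) {f : ℂ → ℂ} (hf : f ∈ BSect φ) :
    ∃ n : ℕ, ∀ m, n ≤ m → (fun z => tau z ^ (m + 1)) ∈ Reg A ω φ f := by
  have h0 := hA.1.trans hωφ
  obtain ⟨n, hn⟩ := hf
  exact ⟨n, fun m hm => ⟨tau_pow_succ_mem_H0 h0 hφ m,
    tau_pow_mul_mem_H0 h0 hφ (hm.trans m.le_succ) hn,
    elemCalc_tau_pow_succ_injective hA hinj hωφ hφ m⟩⟩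

theorem Reg_mul (hA : IsSect A ω) (hωφ : ω < φ) (hφ : φ ≤ Real.pi) {f e e' : ℂ → ℂ}
    (he : e ∈ H0 φ) (hinj : Function.Injective (elemCalc A ω φ e)) (he' : e' ∈ Reg A ω φ f) :
    (fun z => e z * e' z) ∈ Reg A ω φ f := by
  refine ⟨H0_mul he he'.1, H0_congr (H0_mul he he'.2.1) fun z _ => by ring, ?_⟩
  rw [elemCalc_mul hA hωφ hφ he he'.1]
  exact hinj.comp he'.2.2

theorem elemCalc_mul_apply (hA : IsSect A ω) (hωφ : ω < φ) (hφ : φ ≤ Real.pi) {f g h : ℂ → ℂ}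
    (hf : f ∈ H0 φ) (hg : g ∈ H0 φ) (hh : ∀ z ∈ sector φ, h z = f z * g z) (x : X) :
    elemCalc A ω φ f (elemCalc A ω φ g x) = elemCalc A ω φ h x := by
  rw [elemCalc_congr hA.1 hωφ hφ hh, elemCalc_mul hA hωφ hφ hf hg]
  rfl

theorem elemCalc_comm (hA : IsSect A ω) (hωφ : ω < φ) (hφ : φ ≤ Real.pi) {f g : ℂ → ℂ}
    (hf : f ∈ H0 φ) (hg : g ∈ H0 φ) (x : X) :
    elemCalc A ω φ f (elemCalc A ω φ g x) = elemCalc A ω φ g (elemCalc A ω φ f x) := by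
  rw [elemCalc_mul_apply hA hωφ hφ hf hg (fun _ _ => rfl),
    elemCalc_mul_apply hA hωφ hφ hg hf fun _ _ => mul_comm _ _]

/-! ### The extended calculus -/

/-- The extended calculus does not depend on the regulariser. -/
theorem mem_graph_holCalc (hA : IsSect A ω) (hωφ : ω < φ) (hφ : φ ≤ Real.pi) {f e : ℂ → ℂ}
    (he : e ∈ Reg A ω φ f) {x y : X} : (x, y) ∈ (holCalc A ω φ f).graph ↔
      elemCalc A ω φ e y = elemCalc A ω φ (fun z => e z * f z) x := by
  have hne : (Reg A ω φ f).Nonempty := ⟨e, he⟩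
  -- `a(A) b(A) y = b(A) (a f)(A) x = a(A) (b f)(A) x`, and `a(A)` is injective.
  have key : ∀ a ∈ Reg A ω φ f, ∀ b ∈ Reg A ω φ f,
      elemCalc A ω φ a y = elemCalc A ω φ (fun z => a z * f z) x →
      elemCalc A ω φ b y = elemCalc A ω φ (fun z => b z * f z) x := by
    intro a ha b hb h
    apply ha.2.2
    rw [elemCalc_comm hA hωφ hφ ha.1 hb.1, h,
      elemCalc_mul_apply hA hωφ hφ hb.1 ha.2.1 (fun _ _ => rfl),
      elemCalc_mul_apply hA hωφ hφ ha.1 hb.2.1 (h := fun z => b z * (a z * f z))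
        fun z _ => by ring]
  rw [holCalc, dif_pos hne, mem_graph_opMul]
  simp only [mem_graph_ofBdd, mem_graph_inverse_ofBdd hne.some_mem.2.2, exists_eq_left]
  exact ⟨key _ hne.some_mem _ he, key _ he _ hne.some_mem⟩

/-- Membership in `H(A)` may be witnessed on a different sector for each function; this lets all of
them be compared on a common one. -/
theorem holCalc_of_le (hA : IsSect A ω) (hinj : Function.Injective A) {ψ : ℝ} (hωφ : ω < φ)
    (hφψ : φ ≤ ψ) (hψ : ψ < Real.pi) {f : ℂ → ℂ} (hf : f ∈ BSect ψ) :
    holCalc A ω φ f = holCalc A ω ψ f := by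
  obtain ⟨n, hn⟩ := exists_tau_pow_mem_Reg hA hinj (hωφ.trans_le hφψ) hψ hf
  obtain ⟨n', hn'⟩ := exists_tau_pow_mem_Reg hA hinj hωφ (hφψ.trans_lt hψ) (BSect_anti hφψ hf)
  have h := hn _ (le_max_left n n')
  have h' := hn' _ (le_max_right n n')
  refine LinearPMap.eq_of_eq_graph (Submodule.ext fun ⟨x, y⟩ => ?_)
  rw [mem_graph_holCalc hA (hωφ.trans_le hφψ) hψ.le h,
    mem_graph_holCalc hA hωφ (hφψ.trans hψ.le) h', elemCalc_of_le hA hωφ hφψ hψ.le h.1,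
    elemCalc_of_le hA hωφ hφψ hψ.le h.2.1]

theorem exists_elemCalc_mul_eq_of_isBddOp (hA : IsSect A ω) (hωφ : ω < φ) (hφ : φ ≤ Real.pi)
    {f : ℂ → ℂ} (hf : IsBddOp (holCalc A ω φ f)) :
    ∃ B : X →L[ℂ] X, ∀ e ∈ Reg A ω φ f, ∀ x,
      elemCalc A ω φ e (B x) = elemCalc A ω φ (fun z => e z * f z) x := by
  obtain ⟨B, hB⟩ := hf
  refine ⟨B, fun e he x => ?_⟩
  rw [← mem_graph_holCalc hA hωφ hφ he, hB, mem_graph_ofBdd]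

/-- If `g(A) x = y`, then `(f g)(A) x = z` if and only if `f(A) y = z`. -/
theorem mem_graph_holCalc_mul_iff (hA : IsSect A ω) (hωφ : ω < φ) (hφ : φ ≤ Real.pi)
    {f g e : ℂ → ℂ} (hf : e ∈ Reg A ω φ f) (hg : e ∈ Reg A ω φ g)
    (hfg : e ∈ Reg A ω φ fun z => f z * g z) {x y z : X}
    (hxy : (x, y) ∈ (holCalc A ω φ g).graph) :
    (x, z) ∈ (holCalc A ω φ fun z => f z * g z).graph ↔ (y, z) ∈ (holCalc A ω φ f).graph := by
  rw [mem_graph_holCalc hA hωφ hφ hg] at hxy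
  -- Both equations are multiplied once more by the injective `e(A)`. Then both right-hand sides
  -- become `((e f)(e g))(A) x`.
  rw [mem_graph_holCalc hA hωφ hφ hfg, mem_graph_holCalc hA hωφ hφ hf, ← hf.2.2.eq_iff,
    ← hf.2.2.eq_iff (b := elemCalc A ω φ (fun z => e z * f z) y),
    elemCalc_comm hA hωφ hφ hf.1 hf.2.1, hxy,
    elemCalc_mul_apply hA hωφ hφ hf.2.1 hg.2.1 (fun _ _ => rfl),
    elemCalc_mul_apply hA hωφ hφ hf.1 hfg.2.1 (h := fun z => (e z * f z) * (e z * g z))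
      fun z _ => by ring]

open Polynomial in
-- Polynomials in `1/(1+z)` need not lie in `H₀^∞`, so they are paired with a factor `h` that does;
-- multiplication by `1/(1+z)` is `elemCalc_mul_resolvent`.
theorem elemCalc_mul_aeval (hA : IsSect A ω) (hωφ : ω < φ) (hφ : φ < Real.pi) {h : ℂ → ℂ}
    (hh : h ∈ H0 φ) (p : ℂ[X]) : (fun z => h z * p.eval (1 + z)⁻¹) ∈ H0 φ ∧
      elemCalc A ω φ h * aeval (-opResolvent A (-1)) p =
        elemCalc A ω φ (fun z => h z * p.eval (1 + z)⁻¹) ∧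
      aeval (-opResolvent A (-1)) p * elemCalc A ω φ h =
        elemCalc A ω φ (fun z => h z * p.eval (1 + z)⁻¹) := by
  have h0 := hA.1.trans hωφ
  induction p using Polynomial.induction_on with
  | C a =>
    simp only [eval_C, aeval_C, elemCalc_mul_const, Algebra.algebraMap_eq_smul_one, mul_smul_comm,
      smul_mul_assoc, mul_one, one_mul, and_self, and_true]
    exact H0_mul_const hh a
  | add p q hp hq =>
    simp only [eval_add, map_add, mul_add, add_mul]
    rw [elemCalc_add hA hωφ hφ.le hp.1 hq.1, hp.2.1, hq.2.1, hp.2.2, hq.2.2]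
    exact ⟨H0_add hp.1 hq.1, rfl, rfl⟩
  | monomial n a hp =>
    rw [pow_succ, ← mul_assoc]
    generalize C a * Polynomial.X ^ n = p at hp ⊢
    have hT := elemCalc_mul_resolvent hA hωφ hφ hp.1
    simp only [eval_mul, eval_X, ← mul_assoc]
    refine ⟨H0_mul_inv_one_add h0 hφ hp.1, ?_, ?_⟩
    · rw [map_mul, aeval_X, ← mul_assoc, hp.2.1, hT.1]
    · rw [mul_comm p, map_mul, aeval_X, mul_assoc, hp.2.2, hT.2]

open Polynomial in
/-- `dom((f g)(A)) ⊆ dom(g(A))` if `g / (1 + z)^m` and `z^r / (f (1 + z)^r)` belong to `H(A)`. -/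
theorem exists_mem_graph_holCalc_right (hA : IsSect A ω) (hωφ : ω < φ) (hφ : φ < Real.pi)
    {f g e : ℂ → ℂ} {m r : ℕ} (hf0 : ∀ z ∈ sector φ, f z ≠ 0)
    (hg : e ∈ Reg A ω φ g) (hfg : e ∈ Reg A ω φ fun z => f z * g z)
    (hg' : e ∈ Reg A ω φ fun z => g z / (1 + z) ^ m)
    (hf' : e ∈ Reg A ω φ fun z => z ^ r / (f z * (1 + z) ^ r))
    (h2 : IsBddOp (holCalc A ω φ fun z => g z / (1 + z) ^ m))
    (h3 : IsBddOp (holCalc A ω φ fun z => z ^ r / (f z * (1 + z) ^ r))) {x y : X}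
    (hxy : (x, y) ∈ (holCalc A ω φ fun z => f z * g z).graph) :
    ∃ u, (x, u) ∈ (holCalc A ω φ g).graph := by
  obtain ⟨B₂, hB₂⟩ := exists_elemCalc_mul_eq_of_isBddOp hA hωφ hφ.le h2
  obtain ⟨B₃, hB₃⟩ := exists_elemCalc_mul_eq_of_isBddOp hA hωφ hφ.le h3
  rw [mem_graph_holCalc hA hωφ hφ.le hfg] at hxy
  -- The variable stands for `1/(1+z)`, hence `1 - X` for `z/(1+z)`.
  have hcop : IsCoprime ((1 - Polynomial.X : ℂ[X]) ^ r) (Polynomial.X ^ m) :=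
    IsCoprime.pow ⟨1, 1, by ring⟩
  obtain ⟨p, q, hpq⟩ := hcop
  have hee := H0_mul hg.1 hg.1
  set T := -opResolvent A (-1) with hT
  -- The value predicted by multiplying the Bézout identity by `g`.
  refine ⟨aeval T p (B₃ y) + aeval T q (B₂ x), ?_⟩
  -- The regulariser is `e²`: one factor `e` handles `B₃`, the other `(fg)(A) x = y`.
  rw [mem_graph_holCalc hA hωφ hφ.le (Reg_mul hA hωφ hφ.le hg.1 hg.2.2 hg)]
  have comm : ∀ (p : ℂ[X]) (v : X), elemCalc A ω φ (fun z => e z * e z) (aeval T p v) =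
      aeval T p (elemCalc A ω φ (fun z => e z * e z) v) := fun p v =>
    DFunLike.congr_fun ((elemCalc_mul_aeval hA hωφ hφ hee p).2.1.trans
      (elemCalc_mul_aeval hA hωφ hφ hee p).2.2.symm) v
  have e3 : elemCalc A ω φ (fun z => e z * e z) (B₃ y) = elemCalc A ω φ
      (fun z => (e z * (z ^ r / (f z * (1 + z) ^ r))) * (e z * (f z * g z))) x := by
    rw [← elemCalc_mul_apply hA hωφ hφ.le hg.1 hg.1 (fun _ _ => rfl), hB₃ e hf',
      elemCalc_comm hA hωφ hφ.le hf'.1 hf'.2.1, hxy,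
      elemCalc_mul_apply hA hωφ hφ.le hf'.2.1 hfg.2.1 fun _ _ => rfl]
  have e2 : elemCalc A ω φ (fun z => e z * e z) (B₂ x) = elemCalc A ω φ
      (fun z => e z * (e z * (g z / (1 + z) ^ m))) x := by
    rw [← elemCalc_mul_apply hA hωφ hφ.le hg.1 hg.1 (fun _ _ => rfl), hB₂ e hg',
      elemCalc_mul_apply hA hωφ hφ.le hg.1 hg'.2.1 fun _ _ => rfl]
  have k3 := elemCalc_mul_aeval hA hωφ hφ (H0_mul hf'.2.1 hfg.2.1) p
  have k2 := elemCalc_mul_aeval hA hωφ hφ (H0_mul hg.1 hg'.2.1) q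
  rw [map_add, comm, comm, e3, e2]
  change (aeval T p * elemCalc A ω φ _ + aeval T q * elemCalc A ω φ _) x = _
  rw [k3.2.2, k2.2.2, ← elemCalc_add hA hωφ hφ.le k3.1 k2.1]
  congr 1
  refine elemCalc_congr hA.1 hωφ hφ.le fun z hz => ?_
  have hz1 := one_add_ne_zero hφ.le hz
  have hfz := hf0 z hz
  have hev := congrArg (Polynomial.eval (1 + z)⁻¹) hpq
  simp only [eval_add, eval_mul, eval_pow, eval_sub, eval_one, eval_X] at hev
  rw [show 1 - (1 + z)⁻¹ = z / (1 + z) by field_simp; ring, div_pow, inv_pow] at hev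
  have hc : z ^ r / (f z * (1 + z) ^ r) * f z = z ^ r / (1 + z) ^ r := by field_simp
  generalize eval (1 + z)⁻¹ p = P at hev ⊢
  linear_combination e z * e z * g z * hev + e z * e z * g z * P * hc

end Extended

end HolCalc

end

/-! ### The product formula -/

theorem corollary3p2 {X : Type*} [NormedAddCommGroup X] [NormedSpace ℂ X] [CompleteSpace X]
    (A : X →ₗ.[ℂ] X) (ω φ : ℝ)
    (hA : HolCalc.IsSect A ω) (hinj : Function.Injective A)
    (hωφ : ω < φ) (hφ : φ < Real.pi)
    (f g : ℂ → ℂ)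
    (hf : f ∈ HolCalc.BSect φ) (hg : g ∈ HolCalc.BSect φ)
    (hf0 : ∀ z ∈ HolCalc.sector φ, f z ≠ 0)
    (hfinv : (fun z => 1 / f z) ∈ HolCalc.BSect φ)
    (k m r : ℕ)
    (h1 : (fun z => f z / (1 + z) ^ k) ∈ HolCalc.HBdd A ω)
    (h2 : (fun z => g z / (1 + z) ^ m) ∈ HolCalc.HBdd A ω)
    (h3 : (fun z => z ^ r / (f z * (1 + z) ^ r)) ∈ HolCalc.HBdd A ω) :
    HolCalc.holCalc A ω φ (fun z => f z * g z) =
      HolCalc.opMul (HolCalc.holCalc A ω φ f) (HolCalc.holCalc A ω φ g) := by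
  open HolCalc in
  obtain ⟨φ₂, hφ₂, hφ₂', hB₂, hb₂⟩ := h2
  obtain ⟨φ₃, hφ₃, hφ₃', hB₃, hb₃⟩ := h3
  obtain ⟨ψ, hψ⟩ : ∃ ψ, ψ = min φ (min φ₂ φ₃) := ⟨_, rfl⟩
  have hωψ : ω < ψ := by rw [hψ]; exact lt_min hωφ (lt_min hφ₂ hφ₃)
  have hψφ : ψ ≤ φ := hψ ▸ min_le_left _ _
  have hψφ₂ : ψ ≤ φ₂ := hψ ▸ (min_le_right _ _).trans (min_le_left _ _)
  have hψφ₃ : ψ ≤ φ₃ := hψ ▸ (min_le_right _ _).trans (min_le_right _ _)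
  have hψπ := hψφ.trans_lt hφ
  have hfg := BSect_mul hf hg
  rw [← holCalc_of_le hA hinj hωψ hψφ hφ hf, ← holCalc_of_le hA hinj hωψ hψφ hφ hg,
    ← holCalc_of_le hA hinj hωψ hψφ hφ hfg]
  rw [← holCalc_of_le hA hinj hωψ hψφ₂ hφ₂' hB₂] at hb₂
  rw [← holCalc_of_le hA hinj hωψ hψφ₃ hφ₃' hB₃] at hb₃
  obtain ⟨n₁, hn₁⟩ := exists_tau_pow_mem_Reg hA hinj hωψ hψπ (BSect_anti hψφ hf)
  obtain ⟨n₂, hn₂⟩ := exists_tau_pow_mem_Reg hA hinj hωψ hψπ (BSect_anti hψφ hg)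
  obtain ⟨n₃, hn₃⟩ := exists_tau_pow_mem_Reg hA hinj hωψ hψπ (BSect_anti hψφ hfg)
  obtain ⟨n₄, hn₄⟩ := exists_tau_pow_mem_Reg hA hinj hωψ hψπ (BSect_anti hψφ₂ hB₂)
  obtain ⟨n₅, hn₅⟩ := exists_tau_pow_mem_Reg hA hinj hωψ hψπ (BSect_anti hψφ₃ hB₃)
  -- One power of `τ` that regularises all five functions at once.
  set N := n₁ + n₂ + n₃ + n₄ + n₅
  have r₁ := hn₁ N (by omega)
  have r₂ := hn₂ N (by omega)
  have r₃ := hn₃ N (by omega)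
  have r₄ := hn₄ N (by omega)
  have r₅ := hn₅ N (by omega)
  refine LinearPMap.eq_of_eq_graph (Submodule.ext fun ⟨x, z⟩ => ?_)
  rw [mem_graph_opMul]
  constructor
  · intro h
    obtain ⟨y, hy⟩ := exists_mem_graph_holCalc_right hA hωψ hψπ
      (fun z hz => hf0 z (sector_mono hψφ hz)) r₂ r₃ r₄ r₅ hb₂ hb₃ h
    exact ⟨y, hy, (mem_graph_holCalc_mul_iff hA hωψ hψπ.le r₁ r₂ r₃ hy).1 h⟩
  · rintro ⟨y, hy, hz⟩
    exact (mem_graph_holCalc_mul_iff hA hωψ hψπ.le r₁ r₂ r₃ hy).2 hz
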